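/- Let $X$ be a smooth (finite-dimensional, Hausdorff, boundaryless) manifold, let $\nabla^X$ be a smooth linear connection on $TX$, and let $G$ be a Lie group with identity $e$ and Lie algebra $\mathfrak g=T_eG$ (bracket of left-invariant vector fields, $\mathrm{ad}(\xi)(\eta)=[\xi,\eta]$, and $\mathrm{Ad}_g$ the derivative at $e$ of $h\mapsto ghg^{-1}$). Let $k$ be a positive integer, and let $J^k(X,G)\to X$ be the bundle of $k$-jets $j^k_xg$ of local smooth maps $g:X\to G$. The fibered multiplication $(j^k_xg)(j^k_xh)=j^k_x(gh)$ makes $J^k(X,G)\rightrightarrows X$ a groupoid whose source and target maps are both the projection to $X$, i.e. a bundle of groups. For a local smooth map $g:X\to G$ set $$\xi^{(1)}=dR_{g^{-1}}\circ dg\in\Gamma(T^*X\otimes\mathfrak g),\qquad \xi^{(j)}=\tilde\nabla^{(j-1)}\xi^{(j-1)}\in\Gamma\Big(\bigotimes^jT^*X\otimes\mathfrak g\Big),\quad 2\le j\le k,$$ where $\tilde\nabla^{(j)}$ is the connection on $\bigotimes^jT^*X\otimes\mathfrak g$ induced by $\nabla^X$ and the trivial connection on $\mathfrak g$, with the direction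 of differentiation as first argument: $$(\tilde\nabla^{(j)}\chi)(U,U_1,\dots,U_j)=U\big(\chi(U_1,\dots,U_j)\big)-\sum_{i=1}^j\chi(U_1,\dots,\nabla^X_UU_i,\dots,U_j).$$ The value at $x$ of these tensor fields depends only on $j^k_xg$, and we denote by $(g,\xi^{(1)},\dots,\xi^{(k)})$, with $g=g(x)$ and $\xi^{(j)}=\xi^{(j)}(x)\in\bigotimes^jT_x^*X\otimes\mathfrak g$, the image of $j^k_xg$ in $G\times\bigoplus_{j=1}^k\big(\bigotimes^jT_x^*X\otimes\mathfrak g\big)$. For $j\ge1$ let $\mathcal P^a(j)$ be the set of partitions of $\{1,\dots,j\}$ into non-empty subsets, listed as $\lambda=(\lambda_1,\dots,\lambda_l)$ with $\max\lambda_1<\dots<\max\lambda_l$, and write $j_i=|\lambda_i|$. Then for every $x\in X$ and every element of $J^k_x(X,G)$ with image $(g,\xi^{(1)},\dots,\xi^{(k)})$, the inverse of this element in the groupoid $J^k(X,G)\rightrightarrows X$ has image $(g^{-1},\omega^{(1)},\dots,\omega^{(k)})$, where for $1\le j\le k$ $$\omega^{(j)}=\sum_{\lambda\in\mathcal P^a(j)}(-1)^l\,\mathrm{Ad}_{g^{-1}}\circ\Big(\mathrm{ad}\big(\xi^{(j_1)}\big)\cdots\mathrm{ad}\big(\xi^{(j_{l-1})}\big)\big(\xi^{(j_l)}\big)\Big).$$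 Here, in the term of $\lambda$, the factor $\xi^{(j_i)}$ is evaluated on the arguments whose positions form the block $\lambda_i$, in increasing order: for $v_1,\dots,v_j\in T_xX$, $$\omega^{(j)}(v_1,\dots,v_j)=\sum_{\lambda\in\mathcal P^a(j)}(-1)^l\,\mathrm{Ad}_{g^{-1}}\Big(\mathrm{ad}\big(\xi^{(j_1)}(v_{\lambda_1})\big)\cdots\mathrm{ad}\big(\xi^{(j_{l-1})}(v_{\lambda_{l-1}})\big)\big(\xi^{(j_l)}(v_{\lambda_l})\big)\Big),$$ with $v_{\lambda_i}=(v_{r_1},\dots,v_{r_{j_i}})$ when $\lambda_i=\{r_1<\dots<r_{j_i}\}$. -/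

import Mathlib

set_option linter.unusedSectionVars false
open Set Filter Topology Function
open scoped Manifold ContDiff Bundle

section Taylor
variable {E F F' W : Type*} [NormedAddCommGroup E] [NormedSpace ℝ E]
  [NormedAddCommGroup F] [NormedSpace ℝ F] [NormedAddCommGroup F'] [NormedSpace ℝ F']
  [NormedAddCommGroup W] [NormedSpace ℝ W]

/-- Two maps have the same derivatives at `a` up to order `k`. -/
def SameTaylor (k : ℕ) (a : E) (u v : E → F) : Prop :=
  ∀ i ≤ k, iteratedFDeriv ℝ i u a = iteratedFDeriv ℝ i v a

theorem SameTaylor.value {k : ℕ} {a : E} {u v : E → F} (h : SameTaylor k a u v) : u a = v a := by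
  have := congrArg (fun m => m 0) (h 0 (Nat.zero_le _))
  simpa using this

theorem SameTaylor.congr {k : ℕ} {a : E} {u v u' v' : E → F} (h : SameTaylor k a u v)
    (hu : u' =ᶠ[𝓝 a] u) (hv : v' =ᶠ[𝓝 a] v) : SameTaylor k a u' v' := fun i hi => by
  rw [(hu.iteratedFDeriv ℝ i).eq_of_nhds, (hv.iteratedFDeriv ℝ i).eq_of_nhds, h i hi]

theorem SameTaylor.comp {k : ℕ} {a : E} {u v : E → F} (h : SameTaylor k a u v)
    {w : F → W} (hw : ContDiffAt ℝ ∞ w (u a)) (hu : ContDiffAt ℝ ∞ u a)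
    (hv : ContDiffAt ℝ ∞ v a) : SameTaylor k a (w ∘ u) (w ∘ v) := fun i hi => by
  have hle : ((i : ℕ∞) : WithTop ℕ∞) ≤ ∞ := by exact_mod_cast le_top
  rw [iteratedFDeriv_comp hw hu hle, iteratedFDeriv_comp (h.value ▸ hw) hv hle, ← h.value]
  simp only [FormalMultilinearSeries.taylorComp]
  refine Finset.sum_congr rfl fun c _ => ?_
  ext m
  simp only [FormalMultilinearSeries.compAlongOrderedFinpartition_apply]
  congr 1
  ext j
  simp only [OrderedFinpartition.applyOrderedFinpartition, ftaylorSeries]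
  rw [h _ ((c.partSize_le j).trans hi)]

theorem SameTaylor.prodMk {k : ℕ} {a : E} {u v : E → F} {u' v' : E → F'}
    (h : SameTaylor k a u v) (h' : SameTaylor k a u' v') (hu : ContDiffAt ℝ ∞ u a)
    (hv : ContDiffAt ℝ ∞ v a) (hu' : ContDiffAt ℝ ∞ u' a) (hv' : ContDiffAt ℝ ∞ v' a) :
    SameTaylor k a (fun y => (u y, u' y)) (fun y => (v y, v' y)) := fun i hi => by
  have hle : ((i : ℕ∞) : WithTop ℕ∞) ≤ ∞ := by exact_mod_cast le_top
  rw [iteratedFDeriv_prodMk hu hu' hle, iteratedFDeriv_prodMk hv hv' hle, h i hi, h' i hi]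

theorem SameTaylor.refl (k : ℕ) (a : E) (u : E → F) : SameTaylor k a u u := fun _ _ => rfl

theorem SameTaylor.fderiv {k : ℕ} {a : E} {u v : E → F} (h : SameTaylor (k + 1) a u v) :
    SameTaylor k a (fderiv ℝ u) (fderiv ℝ v) := fun i hi => by
  have := h (i + 1) (by omega)
  rw [iteratedFDeriv_succ_eq_comp_right, iteratedFDeriv_succ_eq_comp_right] at this
  simpa using this

end Taylor

section Jets
variable {E : Type*} [NormedAddCommGroup E] [NormedSpace ℝ E]
  {X : Type*} [TopologicalSpace X] [ChartedSpace E X]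
  {F : Type*} [NormedAddCommGroup F] [NormedSpace ℝ F]
  {M : Type*} [TopologicalSpace M] [ChartedSpace F M]
  {F' : Type*} [NormedAddCommGroup F'] [NormedSpace ℝ F']
  {M' : Type*} [TopologicalSpace M'] [ChartedSpace F' M']
  {W : Type*} [NormedAddCommGroup W] [NormedSpace ℝ W]
  {N : Type*} [TopologicalSpace N] [ChartedSpace W N]

variable (E F) in
/-- Two maps `X → M` between manifolds have the same `k`-jet at `x`: they have the same value at
`x` and, read in charts around `x` and around this value, the same derivatives up to order `k`. -/
def JetEq (k : ℕ) (x : X) (g h : X → M) : Prop :=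
  g x = h x ∧
    SameTaylor k (extChartAt 𝓘(ℝ, E) x x)
      (writtenInExtChartAt 𝓘(ℝ, E) 𝓘(ℝ, F) x g) (writtenInExtChartAt 𝓘(ℝ, E) 𝓘(ℝ, F) x h)

theorem JetEq.refl (k : ℕ) (x : X) (g : X → M) : JetEq E F k x g g := ⟨rfl, SameTaylor.refl _ _ _⟩

theorem JetEq.symm {k : ℕ} {x : X} {g h : X → M} (H : JetEq E F k x g h) : JetEq E F k x h g :=
  ⟨H.1.symm, fun i hi => (H.2 i hi).symm⟩

theorem JetEq.trans {k : ℕ} {x : X} {g h l : X → M} (H : JetEq E F k x g h) (H' : JetEq E F k x h l) :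
    JetEq E F k x g l :=
  ⟨H.1.trans H'.1, fun i hi => (H.2 i hi).trans (H'.2 i hi)⟩

theorem jetEq_vector_iff {k : ℕ} {x : X} {f f' : X → W} :
    JetEq E W k x f f' ↔ SameTaylor k (extChartAt 𝓘(ℝ, E) x x)
      (f ∘ (extChartAt 𝓘(ℝ, E) x).symm) (f' ∘ (extChartAt 𝓘(ℝ, E) x).symm) := by
  refine ⟨fun h => by simpa only [writtenInExtChartAt, extChartAt_model_space_eq_id, PartialEquiv.refl_coe, Function.id_comp] using h.2,
    fun h => ⟨?_, ?_⟩⟩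
  · simpa using h.value
  · simpa only [writtenInExtChartAt, extChartAt_model_space_eq_id, PartialEquiv.refl_coe,
      Function.id_comp] using h

theorem tendsto_extChartAt_symm (x : X) :
    Tendsto (extChartAt 𝓘(ℝ, E) x).symm (𝓝 (extChartAt 𝓘(ℝ, E) x x)) (𝓝 x) := by
  have := continuousAt_extChartAt_symm (I := 𝓘(ℝ, E)) x
  simpa [ContinuousAt] using this

theorem JetEq.congr {k : ℕ} {x : X} {g h g' h' : X → M} (H : JetEq E F k x g h)
    (hg : g' =ᶠ[𝓝 x] g) (hh : h' =ᶠ[𝓝 x] h) : JetEq E F k x g' h' := by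
  refine ⟨by rw [hg.eq_of_nhds, hh.eq_of_nhds, H.1], H.2.congr ?_ ?_⟩
  · filter_upwards [(tendsto_extChartAt_symm x).eventually hg] with y hy
    simp only [writtenInExtChartAt, Function.comp_apply, hy, hg.eq_of_nhds]
  · filter_upwards [(tendsto_extChartAt_symm x).eventually hh] with y hy
    simp only [writtenInExtChartAt, Function.comp_apply, hy, hh.eq_of_nhds]

theorem contDiffAt_written {x : X} {g : X → M}
    (hg : ContMDiffAt 𝓘(ℝ, E) 𝓘(ℝ, F) ∞ g x) :
    ContDiffAt ℝ ∞ (writtenInExtChartAt 𝓘(ℝ, E) 𝓘(ℝ, F) x g) (extChartAt 𝓘(ℝ, E) x x) := by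
  have := (contMDiffAt_iff.1 hg).2
  simpa [contDiffWithinAt_univ] using this

theorem contDiffAt_chart_of_vector {x : X} {f : X → W}
    (hf : ContMDiffAt 𝓘(ℝ, E) 𝓘(ℝ, W) ∞ f x) :
    ContDiffAt ℝ ∞ (f ∘ (extChartAt 𝓘(ℝ, E) x).symm) (extChartAt 𝓘(ℝ, E) x x) := by
  have := contDiffAt_written hf
  simpa only [writtenInExtChartAt, extChartAt_model_space_eq_id, PartialEquiv.refl_coe,
    Function.id_comp] using this

theorem contMDiffAt_of_chart_vector [IsManifold 𝓘(ℝ, E) ∞ X] {x : X} {f : X → W}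
    (hf : ContDiffAt ℝ ∞ (f ∘ (extChartAt 𝓘(ℝ, E) x).symm) (extChartAt 𝓘(ℝ, E) x x)) :
    ContMDiffAt 𝓘(ℝ, E) 𝓘(ℝ, W) ∞ f x := by
  have h1 : ContMDiffAt 𝓘(ℝ, E) 𝓘(ℝ, W) ∞
      ((f ∘ (extChartAt 𝓘(ℝ, E) x).symm) ∘ (extChartAt 𝓘(ℝ, E) x)) x :=
    hf.contMDiffAt.comp x contMDiffAt_extChartAt
  refine h1.congr_of_eventuallyEq ?_
  filter_upwards [extChartAt_source_mem_nhds (I := 𝓘(ℝ, E)) x] with y hy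
  exact congrArg f ((extChartAt 𝓘(ℝ, E) x).left_inv hy).symm

/-- Read in charts, a map is near `x` the inverse chart applied to its chart expression. -/
theorem eventually_chart_symm_written {x : X} {g : X → M} (hg : ContinuousAt g x) :
    ∀ᶠ p in 𝓝 (extChartAt 𝓘(ℝ, E) x x),
      (extChartAt 𝓘(ℝ, F) (g x)).symm (writtenInExtChartAt 𝓘(ℝ, E) 𝓘(ℝ, F) x g p) =
        g ((extChartAt 𝓘(ℝ, E) x).symm p) := by
  have := hg.eventually (extChartAt_source_mem_nhds (I := 𝓘(ℝ, F)) (g x))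
  filter_upwards [(tendsto_extChartAt_symm x).eventually this] with p hp
  exact (extChartAt 𝓘(ℝ, F) (g x)).left_inv hp

/-- Binary smooth operations respect jets. -/
theorem JetEq.map₂ [IsManifold 𝓘(ℝ, F) ∞ M] [IsManifold 𝓘(ℝ, F') ∞ M'] [IsManifold 𝓘(ℝ, W) ∞ N]
    {k : ℕ} {x : X} {g g' : X → M} {h h' : X → M'}
    (Hg : JetEq E F k x g g') (Hh : JetEq E F' k x h h')
    (hg : ContMDiffAt 𝓘(ℝ, E) 𝓘(ℝ, F) ∞ g x) (hg' : ContMDiffAt 𝓘(ℝ, E) 𝓘(ℝ, F) ∞ g' x)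
    (hh : ContMDiffAt 𝓘(ℝ, E) 𝓘(ℝ, F') ∞ h x) (hh' : ContMDiffAt 𝓘(ℝ, E) 𝓘(ℝ, F') ∞ h' x)
    {Φ : M → M' → N}
    (hΦ : ContMDiffAt (𝓘(ℝ, F).prod 𝓘(ℝ, F')) 𝓘(ℝ, W) ∞ (fun p : M × M' => Φ p.1 p.2)
      (g x, h x)) :
    JetEq E W k x (fun y => Φ (g y) (h y)) (fun y => Φ (g' y) (h' y)) := by
  set w : F × F' → W := fun p => extChartAt 𝓘(ℝ, W) (Φ (g x) (h x))
    (Φ ((extChartAt 𝓘(ℝ, F) (g x)).symm p.1) ((extChartAt 𝓘(ℝ, F') (h x)).symm p.2)) with hw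
  have hws : ContDiffAt ℝ ∞ w
      (extChartAt 𝓘(ℝ, F) (g x) (g x), extChartAt 𝓘(ℝ, F') (h x) (h x)) := by
    have := (contMDiffAt_iff.1 hΦ).2
    simpa only [ModelWithCorners.range_eq_univ, contDiffWithinAt_univ, extChartAt_prod,
      PartialEquiv.prod_coe, PartialEquiv.prod_coe_symm, Function.comp_def] using this
  have key : ∀ {u : X → M} {v : X → M'}, u x = g x → v x = h x →
      ContinuousAt u x → ContinuousAt v x →
      writtenInExtChartAt 𝓘(ℝ, E) 𝓘(ℝ, W) x (fun y => Φ (u y) (v y)) =ᶠ[𝓝 (extChartAt 𝓘(ℝ, E) x x)]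
        w ∘ (fun p => (writtenInExtChartAt 𝓘(ℝ, E) 𝓘(ℝ, F) x u p,
          writtenInExtChartAt 𝓘(ℝ, E) 𝓘(ℝ, F') x v p)) := by
    intro u v hu hv cu cv
    filter_upwards [eventually_chart_symm_written (F := F) cu,
      eventually_chart_symm_written (F := F') cv] with p h1 h2
    rw [hu] at h1
    rw [hv] at h2
    simp only [hw, Function.comp_apply, h1, h2]
    simp only [writtenInExtChartAt, Function.comp_apply, hu, hv]
  refine ⟨by simp only [Hg.1, Hh.1], ?_⟩
  refine SameTaylor.congr (SameTaylor.comp (w := w) (SameTaylor.prodMk Hg.2 Hh.2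
    (contDiffAt_written hg) (contDiffAt_written hg') (contDiffAt_written hh)
    (contDiffAt_written hh')) ?_ ?_ ?_) (key rfl rfl hg.continuousAt hh.continuousAt)
    (key Hg.1.symm Hh.1.symm hg'.continuousAt hh'.continuousAt)
  · simpa [writtenInExtChartAt] using hws
  · exact (contDiffAt_written hg).prodMk (contDiffAt_written hh)
  · exact (contDiffAt_written hg').prodMk (contDiffAt_written hh')

end Jets

section Derivation
variable {E : Type*} [NormedAddCommGroup E] [NormedSpace ℝ E]
  {X : Type*} [TopologicalSpace X] [ChartedSpace E X] [IsManifold 𝓘(ℝ, E) ∞ X]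
  {W : Type*} [NormedAddCommGroup W] [NormedSpace ℝ W]

/-- A (not necessarily smooth) vector field. -/
abbrev VecField (E : Type*) [NormedAddCommGroup E] [NormedSpace ℝ E]
    (X : Type*) [TopologicalSpace X] [ChartedSpace E X] : Type _ :=
  ∀ y : X, TangentSpace 𝓘(ℝ, E) y

/-- A map between manifolds is smooth on a neighbourhood of `x`. -/
def SmoothNear {F : Type*} [NormedAddCommGroup F] [NormedSpace ℝ F]
    {M : Type*} [TopologicalSpace M] [ChartedSpace F M] (f : X → M) (x : X) : Prop :=
  ∀ᶠ y in 𝓝 x, ContMDiffAt 𝓘(ℝ, E) 𝓘(ℝ, F) ∞ f y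

/-- The derivative of a vector valued function along a vector field. -/
noncomputable def derivAlong (V : VecField E X) (f : X → W) : X → W :=
  fun y => mvfderiv 𝓘(ℝ, E) f y (V y)

/-- A vector field read in the trivialization of the tangent bundle given by the chart at `x`. -/
noncomputable def coordField (x : X) (V : VecField E X) (p : E) : E :=
  (trivializationAt E (TangentSpace 𝓘(ℝ, E)) x
    ⟨(extChartAt 𝓘(ℝ, E) x).symm p, V ((extChartAt 𝓘(ℝ, E) x).symm p)⟩).2

theorem contDiffAt_coordField {x : X} {V : VecField E X}
    (hV : ContMDiffAt 𝓘(ℝ, E) 𝓘(ℝ, E).tangent ∞ (T% V) x) :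
    ContDiffAt ℝ ∞ (coordField x V) (extChartAt 𝓘(ℝ, E) x x) :=
  contDiffAt_chart_of_vector ((Bundle.contMDiffAt_section x).1 hV)

theorem mvfderiv_eq_chart {x y : X} {f : X → W} (hy : y ∈ (extChartAt 𝓘(ℝ, E) x).source)
    (hf : MDifferentiableAt 𝓘(ℝ, E) 𝓘(ℝ, W) f y) (v : TangentSpace 𝓘(ℝ, E) y) :
    mvfderiv 𝓘(ℝ, E) f y v =
      fderiv ℝ (f ∘ (extChartAt 𝓘(ℝ, E) x).symm) (extChartAt 𝓘(ℝ, E) x y)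
        (trivializationAt E (TangentSpace 𝓘(ℝ, E)) x ⟨y, v⟩).2 := by
  have hy' : y ∈ (chartAt E x).source := by simpa using hy
  have e1 : (trivializationAt E (TangentSpace 𝓘(ℝ, E)) x ⟨y, v⟩).2 =
      mfderiv 𝓘(ℝ, E) 𝓘(ℝ, E) (extChartAt 𝓘(ℝ, E) x) y v := by
    have h := congrArg (fun L => L v)
      (TangentBundle.continuousLinearMapAt_trivializationAt (I := 𝓘(ℝ, E)) hy')
    refine Eq.trans ?_ h
    have hb : y ∈ (trivializationAt E (TangentSpace 𝓘(ℝ, E)) x).baseSet := by simpa using hy'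
    exact (congrFun ((trivializationAt E (TangentSpace 𝓘(ℝ, E)) x).coe_linearMapAt_of_mem
      (R := ℝ) hb) v).symm
  have hφ : MDifferentiableAt 𝓘(ℝ, E) 𝓘(ℝ, E) (extChartAt 𝓘(ℝ, E) x) y :=
    mdifferentiableAt_extChartAt hy'
  have hs : MDifferentiableAt 𝓘(ℝ, E) 𝓘(ℝ, W) (f ∘ (extChartAt 𝓘(ℝ, E) x).symm)
      (extChartAt 𝓘(ℝ, E) x y) := by
    have h1 : MDifferentiableAt 𝓘(ℝ, E) 𝓘(ℝ, E) (extChartAt 𝓘(ℝ, E) x).symm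
        (extChartAt 𝓘(ℝ, E) x y) := by
      have := mdifferentiableWithinAt_extChartAt_symm (I := 𝓘(ℝ, E)) (x := x)
        ((extChartAt 𝓘(ℝ, E) x).map_source hy)
      rwa [ModelWithCorners.range_eq_univ, mdifferentiableWithinAt_univ] at this
    refine MDifferentiableAt.comp _ ?_ h1
    rwa [(extChartAt 𝓘(ℝ, E) x).left_inv hy]
  have hev : f =ᶠ[𝓝 y] (f ∘ (extChartAt 𝓘(ℝ, E) x).symm) ∘ (extChartAt 𝓘(ℝ, E) x) := by
    filter_upwards [extChartAt_source_mem_nhds' (I := 𝓘(ℝ, E)) hy] with z hz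
    exact congrArg f ((extChartAt 𝓘(ℝ, E) x).left_inv hz).symm
  rw [e1, ← mfderiv_eq_fderiv]
  have := hev.mfderiv_eq (I := 𝓘(ℝ, E)) (I' := 𝓘(ℝ, W))
  rw [mfderiv_comp y hs hφ] at this
  exact congrArg (fun L => L v) this

theorem derivAlong_chart {x : X} (V : VecField E X) {f : X → W}
    (hf : ContMDiffAt 𝓘(ℝ, E) 𝓘(ℝ, W) ∞ f x) :
    derivAlong V f ∘ (extChartAt 𝓘(ℝ, E) x).symm =ᶠ[𝓝 (extChartAt 𝓘(ℝ, E) x x)] fun p =>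
      fderiv ℝ (f ∘ (extChartAt 𝓘(ℝ, E) x).symm) p (coordField x V p) := by
  have h1 : ∀ᶠ y in 𝓝 x, MDifferentiableAt 𝓘(ℝ, E) 𝓘(ℝ, W) f y := by
    have : ContMDiffAt 𝓘(ℝ, E) 𝓘(ℝ, W) 1 f x := hf.of_le (by exact_mod_cast le_top)
    filter_upwards [(contMDiffAt_iff_contMDiffAt_nhds (by simp)).1 this] with y hy using
      hy.mdifferentiableAt (by simp)
  filter_upwards [(tendsto_extChartAt_symm x).eventually h1,
    extChartAt_target_mem_nhds (I := 𝓘(ℝ, E)) x] with p hp hpt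
  have hps := (extChartAt 𝓘(ℝ, E) x).map_target hpt
  have := mvfderiv_eq_chart hps hp (V _)
  rw [(extChartAt 𝓘(ℝ, E) x).right_inv hpt] at this
  exact this

theorem contMDiffAt_derivAlong {x : X} {V : VecField E X} {f : X → W}
    (hV : ContMDiffAt 𝓘(ℝ, E) 𝓘(ℝ, E).tangent ∞ (T% V) x)
    (hf : ContMDiffAt 𝓘(ℝ, E) 𝓘(ℝ, W) ∞ f x) :
    ContMDiffAt 𝓘(ℝ, E) 𝓘(ℝ, W) ∞ (derivAlong V f) x := by
  refine contMDiffAt_of_chart_vector (ContDiffAt.congr_of_eventuallyEq ?_ (derivAlong_chart V hf))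
  exact ((contDiffAt_chart_of_vector hf).fderiv_right (by simp)).clm_apply
    (contDiffAt_coordField hV)

theorem jetEq_derivAlong {k : ℕ} {x : X} {V : VecField E X} {f f' : X → W}
    (hV : ContMDiffAt 𝓘(ℝ, E) 𝓘(ℝ, E).tangent ∞ (T% V) x)
    (hf : ContMDiffAt 𝓘(ℝ, E) 𝓘(ℝ, W) ∞ f x) (hf' : ContMDiffAt 𝓘(ℝ, E) 𝓘(ℝ, W) ∞ f' x)
    (H : JetEq E W (k + 1) x f f') : JetEq E W k x (derivAlong V f) (derivAlong V f') := by
  have d {u : X → W} (hu : ContMDiffAt 𝓘(ℝ, E) 𝓘(ℝ, W) ∞ u x) :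
      ContDiffAt ℝ ∞ (fderiv ℝ (u ∘ (extChartAt 𝓘(ℝ, E) x).symm)) (extChartAt 𝓘(ℝ, E) x x) :=
    (contDiffAt_chart_of_vector hu).fderiv_right (by simp)
  have hc := contDiffAt_coordField hV
  refine jetEq_vector_iff.2 (SameTaylor.congr (SameTaylor.comp
    (w := fun q : (E →L[ℝ] W) × E => q.1 q.2)
    (SameTaylor.prodMk (jetEq_vector_iff.1 H).fderiv (SameTaylor.refl k _ (coordField x V))
      (d hf) (d hf') hc hc) ?_ ((d hf).prodMk hc) ((d hf').prodMk hc))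
    (derivAlong_chart V hf) (derivAlong_chart V hf'))
  exact (contDiff_fst.clm_apply contDiff_snd).contDiffAt

end Derivation

section LogDeriv
variable {E : Type*} [NormedAddCommGroup E] [NormedSpace ℝ E]
  {X : Type*} [TopologicalSpace X] [ChartedSpace E X] [IsManifold 𝓘(ℝ, E) ∞ X]
  {F : Type*} [NormedAddCommGroup F] [NormedSpace ℝ F]
  {G : Type*} [TopologicalSpace G] [ChartedSpace F G] [Group G] [LieGroup 𝓘(ℝ, F) ∞ G]

/-- The right logarithmic derivative `dR_{g(y)⁻¹} ∘ (dg)_y : T_y X → 𝔤 = T_1 G` of `g : X → G`. -/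
noncomputable def rightLogDeriv (g : X → G) (y : X) :
    TangentSpace 𝓘(ℝ, E) y →L[ℝ] GroupLieAlgebra 𝓘(ℝ, F) G :=
  (mfderiv 𝓘(ℝ, F) 𝓘(ℝ, F) (fun h : G => h * (g y)⁻¹) (g y)).comp
    (mfderiv 𝓘(ℝ, E) 𝓘(ℝ, F) g y)

theorem rightLogDeriv_eq {g : X → G} {y : X} (hg : ContMDiffAt 𝓘(ℝ, E) 𝓘(ℝ, F) ∞ g y)
    (v : TangentSpace 𝓘(ℝ, E) y) :
    (rightLogDeriv g y v : F) =
      mvfderiv 𝓘(ℝ, E) (fun z => extChartAt 𝓘(ℝ, F) (1 : G) (g z * (g y)⁻¹)) y v := by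
  have hinf : (∞ : WithTop ℕ∞) ≠ 0 := by simp
  have hu : MDifferentiableAt 𝓘(ℝ, E) 𝓘(ℝ, F) (fun z => g z * (g y)⁻¹) y :=
    (hg.mul contMDiffAt_const).mdifferentiableAt hinf
  have hr : MDifferentiableAt 𝓘(ℝ, F) 𝓘(ℝ, F) (fun h : G => h * (g y)⁻¹) (g y) :=
    (contMDiffAt_id.mul contMDiffAt_const : ContMDiffAt 𝓘(ℝ, F) 𝓘(ℝ, F) ∞
      (fun h : G => h * (g y)⁻¹) (g y)).mdifferentiableAt hinf
  have h1 : mfderiv 𝓘(ℝ, E) 𝓘(ℝ, F) (fun z => g z * (g y)⁻¹) y =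
      (mfderiv 𝓘(ℝ, F) 𝓘(ℝ, F) (fun h : G => h * (g y)⁻¹) (g y)).comp
        (mfderiv 𝓘(ℝ, E) 𝓘(ℝ, F) g y) :=
    mfderiv_comp y hr (hg.mdifferentiableAt hinf)
  have key : ∀ (u : X → G), u y = 1 → MDifferentiableAt 𝓘(ℝ, E) 𝓘(ℝ, F) u y →
      (mfderiv 𝓘(ℝ, E) 𝓘(ℝ, F) u y v : F) =
        mvfderiv 𝓘(ℝ, E) (fun z => extChartAt 𝓘(ℝ, F) (1 : G) (u z)) y v := by
    intro u hu1 hu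
    have hρ : MDifferentiableAt 𝓘(ℝ, F) 𝓘(ℝ, F) (extChartAt 𝓘(ℝ, F) (1 : G)) (u y) := by
      rw [hu1]; exact mdifferentiableAt_extChartAt (by simp)
    have := mfderiv_comp y hρ hu
    have e : mfderiv 𝓘(ℝ, E) 𝓘(ℝ, F) (fun z => extChartAt 𝓘(ℝ, F) (1 : G) (u z)) y v =
      mfderiv 𝓘(ℝ, F) 𝓘(ℝ, F) (extChartAt 𝓘(ℝ, F) (1 : G)) (u y) (mfderiv 𝓘(ℝ, E) 𝓘(ℝ, F) u y v) :=
      congrArg (fun L => L v) this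
    refine Eq.trans ?_ e.symm
    have id1 : ∀ q : G, q = 1 → ∀ w : F,
        w = (mfderiv 𝓘(ℝ, F) 𝓘(ℝ, F) (extChartAt 𝓘(ℝ, F) (1 : G)) q : F → F) w := by
      rintro q rfl w
      exact (congrArg (fun L => L w) (mfderiv_extChartAt_self (I := 𝓘(ℝ, F)) (x := (1 : G)))).symm
    exact id1 _ hu1 _
  have h2 := key (fun z => g z * (g y)⁻¹) (by simp) hu
  rw [← h2, h1]
  rfl

/-- The right logarithmic derivative of `g`, evaluated on a vector field. -/
noncomputable def rightLogDerivAlong (V : VecField E X) (g : X → G) : X → F :=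
  fun y => rightLogDeriv (F := F) g y (V y)

/-- `(a, b) ↦ a b⁻¹` read in the chart at `g₀` and in the chart at `1`. -/
noncomputable def chartDiv (F : Type*) [NormedAddCommGroup F] [NormedSpace ℝ F]
    {G : Type*} [TopologicalSpace G] [ChartedSpace F G] [Group G] (g₀ : G) (q : F × F) : F :=
  extChartAt 𝓘(ℝ, F) (1 : G)
    ((extChartAt 𝓘(ℝ, F) g₀).symm q.1 * ((extChartAt 𝓘(ℝ, F) g₀).symm q.2)⁻¹)

theorem contDiffAt_chartDiv (g₀ : G) :
    ContDiffAt ℝ ∞ (chartDiv F g₀) (extChartAt 𝓘(ℝ, F) g₀ g₀, extChartAt 𝓘(ℝ, F) g₀ g₀) := by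
  have hm : ContMDiffAt (𝓘(ℝ, F).prod 𝓘(ℝ, F)) 𝓘(ℝ, F) ∞ (fun p : G × G => p.1 * p.2⁻¹)
      (g₀, g₀) := contMDiffAt_fst.mul contMDiffAt_snd.inv
  have := (contMDiffAt_iff.1 hm).2
  simp only [ModelWithCorners.range_eq_univ, contDiffWithinAt_univ, extChartAt_prod,
    PartialEquiv.prod_coe, PartialEquiv.prod_coe_symm, Function.comp_def, mul_inv_cancel] at this
  exact this

/-- The chart expression of the right logarithmic derivative along a vector field. -/
noncomputable def chartLog (q : ((F × F →L[ℝ] F) × (E →L[ℝ] F)) × E) : F :=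
  q.1.1 (q.1.2 q.2, 0)

theorem contDiff_chartLog : ContDiff ℝ ∞ (chartLog (E := E) (F := F)) :=
  (contDiff_fst.comp contDiff_fst).clm_apply
    (((contDiff_snd.comp contDiff_fst).clm_apply contDiff_snd).prodMk contDiff_const)

theorem rightLogDerivAlong_chart {x : X} (V : VecField E X) {g : X → G}
    (hg : SmoothNear (E := E) (F := F) g x) :
    rightLogDerivAlong (F := F) V g ∘ (extChartAt 𝓘(ℝ, E) x).symm
      =ᶠ[𝓝 (extChartAt 𝓘(ℝ, E) x x)] fun p => chartLog
        ((fderiv ℝ (chartDiv F (g x)) (writtenInExtChartAt 𝓘(ℝ, E) 𝓘(ℝ, F) x g p,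
            writtenInExtChartAt 𝓘(ℝ, E) 𝓘(ℝ, F) x g p),
          fderiv ℝ (writtenInExtChartAt 𝓘(ℝ, E) 𝓘(ℝ, F) x g) p), coordField x V p) := by
  have hgx := hg.self_of_nhds
  set γ := writtenInExtChartAt 𝓘(ℝ, E) 𝓘(ℝ, F) x g with hγ
  have hγs : ContDiffAt ℝ ∞ γ (extChartAt 𝓘(ℝ, E) x x) := contDiffAt_written hgx
  have hγ1 : ∀ᶠ p in 𝓝 (extChartAt 𝓘(ℝ, E) x x), DifferentiableAt ℝ γ p := by
    have : ContDiffAt ℝ 1 γ (extChartAt 𝓘(ℝ, E) x x) := hγs.of_le (by exact_mod_cast le_top)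
    filter_upwards [this.eventually (by simp)] with p hp using hp.differentiableAt (by simp)
  have hd1 : ∀ᶠ q in 𝓝 (extChartAt 𝓘(ℝ, F) (g x) (g x), extChartAt 𝓘(ℝ, F) (g x) (g x)),
      DifferentiableAt ℝ (chartDiv F (g x)) q := by
    have : ContDiffAt ℝ 1 (chartDiv F (g x)) _ :=
      (contDiffAt_chartDiv (F := F) (g x)).of_le (by exact_mod_cast le_top)
    filter_upwards [this.eventually (by simp)] with p hp using hp.differentiableAt (by simp)
  have hγc : Tendsto (fun p => (γ p, γ p)) (𝓝 (extChartAt 𝓘(ℝ, E) x x))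
      (𝓝 (extChartAt 𝓘(ℝ, F) (g x) (g x), extChartAt 𝓘(ℝ, F) (g x) (g x))) := by
    have := (hγs.continuousAt.prodMk hγs.continuousAt).tendsto
    simpa [hγ, writtenInExtChartAt] using this
  filter_upwards [(tendsto_extChartAt_symm x).eventually hg, hγ1, hγc.eventually hd1,
    extChartAt_target_mem_nhds (I := 𝓘(ℝ, E)) x,
    (eventually_chart_symm_written (F := F) hgx.continuousAt).eventually_nhds] with p hp hp1 hp2 hpt hps
  have hmem := (extChartAt 𝓘(ℝ, E) x).map_target hpt
  set y := (extChartAt 𝓘(ℝ, E) x).symm p with hy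
  have hyp : extChartAt 𝓘(ℝ, E) x y = p := (extChartAt 𝓘(ℝ, E) x).right_inv hpt
  have hf : MDifferentiableAt 𝓘(ℝ, E) 𝓘(ℝ, F)
      (fun z => extChartAt 𝓘(ℝ, F) (1 : G) (g z * (g y)⁻¹)) y := by
    have hρ : MDifferentiableAt 𝓘(ℝ, F) 𝓘(ℝ, F) (extChartAt 𝓘(ℝ, F) (1 : G)) (g y * (g y)⁻¹) :=
      mdifferentiableAt_extChartAt (by simp)
    exact hρ.comp y ((hp.mul contMDiffAt_const).mdifferentiableAt (by simp))
  have e1 := rightLogDeriv_eq hp (V y)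
  have e2 := mvfderiv_eq_chart hmem hf (V y)
  rw [hyp] at e2
  have e3 : ((fun z => extChartAt 𝓘(ℝ, F) (1 : G) (g z * (g y)⁻¹)) ∘
      (extChartAt 𝓘(ℝ, E) x).symm) =ᶠ[𝓝 p] (chartDiv F (g x)) ∘ (fun p' => (γ p', γ p)) := by
    filter_upwards [hps] with p' hp'
    simp only [Function.comp_apply, chartDiv]
    rw [hp', hps.self_of_nhds]
  have e4 : HasFDerivAt ((chartDiv F (g x)) ∘ (fun p' => (γ p', γ p)))
      ((fderiv ℝ (chartDiv F (g x)) (γ p, γ p)).comp ((fderiv ℝ γ p).prod 0)) p :=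
    HasFDerivAt.comp p hp2.hasFDerivAt (hp1.hasFDerivAt.prodMk (hasFDerivAt_const _ _))
  rw [e3.fderiv_eq, e4.fderiv] at e2
  exact e1.trans e2

theorem contDiffAt_chartLog_parts {x : X} {g : X → G}
    (hg : ContMDiffAt 𝓘(ℝ, E) 𝓘(ℝ, F) ∞ g x) {g₀ : G} (h0 : g x = g₀) :
    ContDiffAt ℝ ∞ (fun p => fderiv ℝ (chartDiv F g₀)
      (writtenInExtChartAt 𝓘(ℝ, E) 𝓘(ℝ, F) x g p, writtenInExtChartAt 𝓘(ℝ, E) 𝓘(ℝ, F) x g p))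
      (extChartAt 𝓘(ℝ, E) x x) := by
  subst h0
  have h := (contDiffAt_chartDiv (F := F) (g x)).fderiv_right (m := ∞) (by simp)
  have h2 := contDiffAt_written hg
  refine ContDiffAt.comp (extChartAt 𝓘(ℝ, E) x x)
    (g := fderiv ℝ (chartDiv F (g x))) ?_ (h2.prodMk h2)
  simpa [writtenInExtChartAt] using h

theorem contMDiffAt_rightLogDerivAlong {x : X} {V : VecField E X} {g : X → G}
    (hV : ContMDiffAt 𝓘(ℝ, E) 𝓘(ℝ, E).tangent ∞ (T% V) x)
    (hg : SmoothNear (E := E) (F := F) g x) :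
    ContMDiffAt 𝓘(ℝ, E) 𝓘(ℝ, F) ∞ (rightLogDerivAlong (F := F) V g) x := by
  have hgx := hg.self_of_nhds
  refine contMDiffAt_of_chart_vector
    (ContDiffAt.congr_of_eventuallyEq ?_ (rightLogDerivAlong_chart V hg))
  exact contDiff_chartLog.contDiffAt.comp (extChartAt 𝓘(ℝ, E) x x)
    (((contDiffAt_chartLog_parts hgx rfl).prodMk
      ((contDiffAt_written hgx).fderiv_right (by simp))).prodMk (contDiffAt_coordField hV))

theorem jetEq_rightLogDerivAlong {k : ℕ} {x : X} {V : VecField E X} {g g' : X → G}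
    (hV : ContMDiffAt 𝓘(ℝ, E) 𝓘(ℝ, E).tangent ∞ (T% V) x)
    (hg : SmoothNear (E := E) (F := F) g x) (hg' : SmoothNear (E := E) (F := F) g' x)
    (H : JetEq E F (k + 1) x g g') :
    JetEq E F k x (rightLogDerivAlong (F := F) V g) (rightLogDerivAlong (F := F) V g') := by
  have hgx := hg.self_of_nhds
  have hgx' := hg'.self_of_nhds
  have hc := contDiffAt_coordField hV
  have d := (contDiffAt_written hgx).fderiv_right (m := ∞) (by simp)
  have d' := (contDiffAt_written hgx').fderiv_right (m := ∞) (by simp)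
  have Hk : SameTaylor k (extChartAt 𝓘(ℝ, E) x x)
      (writtenInExtChartAt 𝓘(ℝ, E) 𝓘(ℝ, F) x g) (writtenInExtChartAt 𝓘(ℝ, E) 𝓘(ℝ, F) x g') :=
    fun i hi => H.2 i (by omega)
  have c := contDiffAt_written hgx
  have c' := contDiffAt_written hgx'
  have q := contDiffAt_chartLog_parts hgx rfl
  have q' := contDiffAt_chartLog_parts hgx' H.1.symm
  have hdiv : SameTaylor k (extChartAt 𝓘(ℝ, E) x x)
      ((fderiv ℝ (chartDiv F (g x))) ∘ fun p => (writtenInExtChartAt 𝓘(ℝ, E) 𝓘(ℝ, F) x g p,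
            writtenInExtChartAt 𝓘(ℝ, E) 𝓘(ℝ, F) x g p))
      ((fderiv ℝ (chartDiv F (g x))) ∘ fun p => (writtenInExtChartAt 𝓘(ℝ, E) 𝓘(ℝ, F) x g' p,
            writtenInExtChartAt 𝓘(ℝ, E) 𝓘(ℝ, F) x g' p)) := by
    refine SameTaylor.comp (Hk.prodMk Hk c c' c c') ?_ (c.prodMk c) (c'.prodMk c')
    have h := (contDiffAt_chartDiv (F := F) (g x)).fderiv_right (m := ∞) (by simp)
    simpa [writtenInExtChartAt] using h
  have e' := rightLogDerivAlong_chart V hg'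
  rw [← H.1] at e'
  refine jetEq_vector_iff.2 (SameTaylor.congr (SameTaylor.comp (w := chartLog)
    ((hdiv.prodMk H.2.fderiv q q' d d').prodMk (SameTaylor.refl k _ (coordField x V))
      (q.prodMk d) (q'.prodMk d') hc hc) contDiff_chartLog.contDiffAt
      ((q.prodMk d).prodMk hc) ((q'.prodMk d').prodMk hc))
    (rightLogDerivAlong_chart V hg) e')

end LogDeriv

section Tower
variable {E : Type*} [NormedAddCommGroup E] [NormedSpace ℝ E] [FiniteDimensional ℝ E]
  {X : Type*} [TopologicalSpace X] [T2Space X] [ChartedSpace E X] [IsManifold 𝓘(ℝ, E) ∞ X]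
  {W : Type*} [NormedAddCommGroup W] [NormedSpace ℝ W]

/-- The vector field is smooth on a neighbourhood of `x`. -/
def SmoothFieldNear (V : VecField E X) (x : X) : Prop :=
  ∀ᶠ y in 𝓝 x, ContMDiffAt 𝓘(ℝ, E) 𝓘(ℝ, E).tangent ∞ (T% V) y

/-- Linear connections on the tangent bundle of `X`. -/
abbrev TangentConnection (E : Type*) [NormedAddCommGroup E] [NormedSpace ℝ E]
    (X : Type*) [TopologicalSpace X] [ChartedSpace E X] [IsManifold 𝓘(ℝ, E) ∞ X] : Type _ :=
  CovariantDerivative 𝓘(ℝ, E) E (TangentSpace 𝓘(ℝ, E) : X → Type _)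

/-- The vector field `∇_V U`. -/
noncomputable def covAlong (conn : TangentConnection E X) (V U : VecField E X) : VecField E X :=
  fun y => conn U y (V y)

theorem SmoothFieldNear.mdiff {V : VecField E X} {x : X} (h : SmoothFieldNear V x) :
    ∀ᶠ y in 𝓝 x, MDifferentiableAt 𝓘(ℝ, E) 𝓘(ℝ, E).tangent (T% V) y :=
  h.mono fun _ hy => hy.mdifferentiableAt (by simp)

theorem SmoothNear.mdiff {f : X → W} {x : X} (h : SmoothNear (E := E) (F := W) f x) :
    ∀ᶠ y in 𝓝 x, MDifferentiableAt 𝓘(ℝ, E) 𝓘(ℝ, W) f y :=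
  h.mono fun _ hy => hy.mdifferentiableAt (by simp)

theorem SmoothFieldNear.covAlong {conn : TangentConnection E X}
    [hconn : CovariantDerivative.ContMDiffCovariantDerivative conn ∞] {V U : VecField E X} {x : X}
    (hV : SmoothFieldNear V x) (hU : SmoothFieldNear U x) :
    SmoothFieldNear (covAlong conn V U) x := by
  filter_upwards [hV, hU.eventually_nhds] with y hVy hUy
  obtain ⟨s, hs, hso, hys⟩ := eventually_nhds_iff.1 hUy
  obtain ⟨f, -, hf⟩ := ((SmoothBumpFunction.nhds_basis_tsupport (I := 𝓘(ℝ, E)) y).mem_iff).1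
    (hso.mem_nhds hys)
  have hglob : ContMDiff 𝓘(ℝ, E) 𝓘(ℝ, E).tangent ∞ (T% ((f : X → ℝ) • U)) := by
    have : ContMDiffOn 𝓘(ℝ, E) 𝓘(ℝ, E).tangent ∞ (T% U) s :=
      fun z hz => (hs z hz).contMDiffWithinAt
    exact ContMDiffOn.smul_section_of_tsupport (f.contMDiff.contMDiffOn) hso hf this
  have h1 := (hconn.contMDiff.contMDiff (σ := (f : X → ℝ) • U)
    (by simpa using hglob.contMDiffOn)).contMDiffAt (x := y) univ_mem
  have h2 := h1.clm_bundle_apply hVy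
  refine h2.congr_of_eventuallyEq ?_
  filter_upwards [f.eventuallyEq_one.eventually_nhds, hso.mem_nhds hys] with z hz hzs
  have hev : ∀ᶠ z' in 𝓝 z, U z' = ((f : X → ℝ) • U) z' := by
    filter_upwards [hz] with z' hz'
    simp [hz']
  have := conn.isCovariantDerivativeOnUniv.congr_of_eventuallyEq
    ((hs z hzs).mdifferentiableAt (by simp)) ((hglob z).mdifferentiableAt (by simp))
    univ_mem hev
  simp only [_root_.covAlong, this]

theorem covAlong_congr (conn : TangentConnection E X) {V V' U U' : VecField E X} {x : X}
    (hV : ∀ᶠ y in 𝓝 x, V y = V' y) (hU : ∀ᶠ y in 𝓝 x, U y = U' y)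
    (sU : SmoothFieldNear U x) (sU' : SmoothFieldNear U' x) :
    ∀ᶠ y in 𝓝 x, covAlong conn V U y = covAlong conn V' U' y := by
  filter_upwards [hV, hU.eventually_nhds, sU.mdiff, sU'.mdiff] with y h1 h2 h3 h4
  rw [covAlong, covAlong, h1,
    conn.isCovariantDerivativeOnUniv.congr_of_eventuallyEq h3 h4 univ_mem h2]

theorem covAlong_add_left (conn : TangentConnection E X) (V V' U : VecField E X) :
    covAlong conn (V + V') U = covAlong conn V U + covAlong conn V' U :=
  funext fun y => map_add (conn U y) _ _

theorem covAlong_smul_left (conn : TangentConnection E X) (φ : X → ℝ) (V U : VecField E X) :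
    covAlong conn (φ • V) U = φ • covAlong conn V U :=
  funext fun y => map_smul (conn U y) _ _

theorem covAlong_add_right (conn : TangentConnection E X) {V U U' : VecField E X} {x : X}
    (sU : SmoothFieldNear U x) (sU' : SmoothFieldNear U' x) :
    ∀ᶠ y in 𝓝 x, covAlong conn V (U + U') y = (covAlong conn V U + covAlong conn V U') y := by
  filter_upwards [sU.mdiff, sU'.mdiff] with y h3 h4
  simp only [covAlong, Pi.add_apply, conn.isCovariantDerivativeOnUniv.add h3 h4]
  rfl

theorem covAlong_smul_right (conn : TangentConnection E X) {V U : VecField E X} {φ : X → ℝ}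
    {x : X} (sφ : SmoothNear (E := E) (F := ℝ) φ x) (sU : SmoothFieldNear U x) :
    ∀ᶠ y in 𝓝 x, covAlong conn V (φ • U) y =
      (φ • covAlong conn V U + derivAlong V φ • U) y := by
  filter_upwards [sU.mdiff, sφ.mdiff] with y h3 h4
  simp only [covAlong, conn.isCovariantDerivativeOnUniv.leibniz h3 h4]
  rfl

theorem SmoothFieldNear.add {V V' : VecField E X} {x : X} (h : SmoothFieldNear V x)
    (h' : SmoothFieldNear V' x) : SmoothFieldNear (V + V') x := by
  filter_upwards [h, h'] with y hy hy' using hy.add_section hy'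

theorem SmoothFieldNear.smul {V : VecField E X} {φ : X → ℝ} {x : X}
    (h : SmoothNear (E := E) (F := ℝ) φ x) (h' : SmoothFieldNear V x) :
    SmoothFieldNear (φ • V) x := by
  filter_upwards [h, h'] with y hy hy' using hy.smul_section hy'

theorem smoothFieldNear_extend {x : X} (v : TangentSpace 𝓘(ℝ, E) x) :
    SmoothFieldNear (FiberBundle.extend E v) x := by
  obtain ⟨s, hs, h⟩ : ∃ s ∈ 𝓝 x, ContMDiffOn 𝓘(ℝ, E) 𝓘(ℝ, E).tangent ∞
      (T% (FiberBundle.extend E v)) s :=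
    FiberBundle.exists_contMDiffOn_extend 𝓘(ℝ, E) E v
  filter_upwards [eventually_mem_nhds_iff.2 hs] with y hy using h.contMDiffAt hy

theorem derivAlong_congr (V : VecField E X) {f f' : X → W} {x : X} (h : f =ᶠ[𝓝 x] f') :
    derivAlong V f =ᶠ[𝓝 x] derivAlong V f' := by
  filter_upwards [h.eventually_nhds] with y hy
  have hy' : f =ᶠ[𝓝 y] f' := hy
  simp only [derivAlong, mvfderiv, hy'.mfderiv_eq]
  rfl

theorem derivAlong_add (V : VecField E X) {f f' : X → W} {x : X}
    (h : SmoothNear (E := E) (F := W) f x) (h' : SmoothNear (E := E) (F := W) f' x) :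
    derivAlong V (f + f') =ᶠ[𝓝 x] derivAlong V f + derivAlong V f' := by
  filter_upwards [h.mdiff, h'.mdiff] with y hy hy'
  simp only [derivAlong, Pi.add_apply, mvfderiv_add hy hy']
  rfl

theorem derivAlong_smul (V : VecField E X) {φ : X → ℝ} {f : X → W} {x : X}
    (h : SmoothNear (E := E) (F := ℝ) φ x) (h' : SmoothNear (E := E) (F := W) f x) :
    derivAlong V (φ • f) =ᶠ[𝓝 x] φ • derivAlong V f + derivAlong V φ • f := by
  filter_upwards [h.mdiff, h'.mdiff] with y hy hy'
  simp only [derivAlong, Pi.add_apply, mvfderiv_smul hy hy']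
  rfl

theorem derivAlong_add_left (V V' : VecField E X) (f : X → W) :
    derivAlong (V + V') f = derivAlong V f + derivAlong V' f :=
  funext fun y => map_add (mvfderiv 𝓘(ℝ, E) f y) _ _

theorem derivAlong_smul_left (φ : X → ℝ) (V : VecField E X) (f : X → W) :
    derivAlong (φ • V) f = φ • derivAlong V f :=
  funext fun y => map_smul (mvfderiv 𝓘(ℝ, E) f y) _ _

/-- A section of `⨂ʲ T*X ⊗ W` (for `W` a vector space), given as the operation that evaluates it on
`j` vector fields. -/
abbrev TensorOp (E : Type*) [NormedAddCommGroup E] [NormedSpace ℝ E]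
    (X : Type*) [TopologicalSpace X] [ChartedSpace E X] (W : Type*) (j : ℕ) : Type _ :=
  (Fin j → VecField E X) → X → W

/-- The operation is, near `x`, a smooth tensor field: it maps vector fields that are smooth near
`x` to functions that are smooth near `x`, it is local, and it is linear over smooth functions in
each of its arguments. -/
structure IsTensorNear {j : ℕ} (T : TensorOp E X W j) (x : X) : Prop where
  smooth : ∀ V : Fin j → VecField E X, (∀ i, SmoothFieldNear (V i) x) →
    SmoothNear (E := E) (F := W) (T V) x
  congr : ∀ V V' : Fin j → VecField E X, (∀ i, SmoothFieldNear (V i) x) →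
    (∀ i, SmoothFieldNear (V' i) x) → (∀ i, ∀ᶠ y in 𝓝 x, V i y = V' i y) → T V =ᶠ[𝓝 x] T V'
  add : ∀ (V : Fin j → VecField E X) (i : Fin j) (A B : VecField E X),
    (∀ i, SmoothFieldNear (V i) x) → SmoothFieldNear A x → SmoothFieldNear B x →
    T (update V i (A + B)) =ᶠ[𝓝 x] T (update V i A) + T (update V i B)
  smul : ∀ (V : Fin j → VecField E X) (i : Fin j) (φ : X → ℝ) (A : VecField E X),
    (∀ i, SmoothFieldNear (V i) x) → SmoothNear (E := E) (F := ℝ) φ x → SmoothFieldNear A x →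
    T (update V i (φ • A)) =ᶠ[𝓝 x] φ • T (update V i A)

/-- The tensor product connection `∇ : Γ(⨂ʲ T*X ⊗ W) → Γ(⨂ʲ⁺¹ T*X ⊗ W)` induced by a connection on
`TX`, the direction of differentiation being the first argument:
`(∇T)(V₀, V₁, …, V_j) = V₀(T(V₁, …, V_j)) - ∑ᵢ T(V₁, …, ∇_{V₀} Vᵢ, …, V_j)`. -/
noncomputable def covTensor (conn : TangentConnection E X) {j : ℕ} (T : TensorOp E X W j) :
    TensorOp E X W (j + 1) :=
  fun V => derivAlong (V 0) (T (Fin.tail V)) -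
    ∑ i : Fin j, T (update (Fin.tail V) i (covAlong conn (V 0) (V i.succ)))

theorem eventuallyEq_finsetSum {ι : Type*} (s : Finset ι) {f f' : ι → X → W} {x : X}
    (h : ∀ i ∈ s, f i =ᶠ[𝓝 x] f' i) : ∑ i ∈ s, f i =ᶠ[𝓝 x] ∑ i ∈ s, f' i := by
  have : ∀ᶠ y in 𝓝 x, ∀ i ∈ s, f i y = f' i y := (Finset.eventually_all s).2 h
  filter_upwards [this] with y hy
  simp only [Finset.sum_apply]
  exact Finset.sum_congr rfl hy

theorem smoothNear_update {j : ℕ} {V : Fin j → VecField E X} {x : X}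
    (hV : ∀ i, SmoothFieldNear (V i) x) (i : Fin j) {A : VecField E X}
    (hA : SmoothFieldNear A x) : ∀ l, SmoothFieldNear (update V i A l) x := by
  intro l
  by_cases h : l = i
  · subst h; simpa using hA
  · simpa [h] using hV l

theorem IsTensorNear.covTensor (conn : TangentConnection E X)
    [CovariantDerivative.ContMDiffCovariantDerivative conn ∞] {j : ℕ} {T : TensorOp E X W j}
    {x : X} (hT : IsTensorNear T x) : IsTensorNear (covTensor conn T) x where
  smooth V hV := by
    have ht : ∀ i, SmoothFieldNear (Fin.tail V i) x := fun i => hV i.succ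
    have h1 := hT.smooth _ ht
    have h2 : ∀ᶠ y in 𝓝 x, ∀ i ∈ (Finset.univ : Finset (Fin j)),
        ContMDiffAt 𝓘(ℝ, E) 𝓘(ℝ, W) ∞
          (T (update (Fin.tail V) i (_root_.covAlong conn (V 0) (V i.succ)))) y :=
      (Finset.eventually_all _).2 fun i _ =>
        hT.smooth _ (smoothNear_update ht i ((hV 0).covAlong (hV i.succ)))
    filter_upwards [hV 0, h1, h2] with y hy0 hy1 hy2
    refine (contMDiffAt_derivAlong hy0 hy1).sub ?_
    have := ContMDiffAt.sum (t := Finset.univ) hy2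
    convert this using 1
    ext z
    simp
  congr V V' hV hV' h := by
    have ht : ∀ i, SmoothFieldNear (Fin.tail V i) x := fun i => hV i.succ
    have ht' : ∀ i, SmoothFieldNear (Fin.tail V' i) x := fun i => hV' i.succ
    have h1 : T (Fin.tail V) =ᶠ[𝓝 x] T (Fin.tail V') := hT.congr _ _ ht ht' fun i => h i.succ
    refine EventuallyEq.sub ?_ (eventuallyEq_finsetSum _ fun i _ => ?_)
    · refine (derivAlong_congr (V 0) h1).trans ?_
      filter_upwards [h 0] with y hy
      simp only [derivAlong, hy]
    · refine hT.congr _ _ (smoothNear_update ht i ((hV 0).covAlong (hV i.succ)))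
        (smoothNear_update ht' i ((hV' 0).covAlong (hV' i.succ))) fun l => ?_
      by_cases hl : l = i
      · subst hl
        simpa using covAlong_congr conn (h 0) (h l.succ) (hV l.succ) (hV' l.succ)
      · simpa [hl, Fin.tail] using h l.succ
  add V i A B hV hA hB := by
    have ht : ∀ i, SmoothFieldNear (Fin.tail V i) x := fun i => hV i.succ
    induction i using Fin.cases with
    | zero =>
      have hs : (∑ l : Fin j, T (update (Fin.tail V) l (covAlong conn (A + B) (V l.succ))))
          =ᶠ[𝓝 x] ∑ l : Fin j, (T (update (Fin.tail V) l (covAlong conn A (V l.succ))) +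
            T (update (Fin.tail V) l (covAlong conn B (V l.succ)))) :=
        eventuallyEq_finsetSum _ fun l _ => by
          rw [covAlong_add_left]
          exact hT.add _ l _ _ ht (hA.covAlong (hV l.succ)) (hB.covAlong (hV l.succ))
      filter_upwards [hs] with y hy
      simp only [_root_.covTensor, Fin.tail_update_zero, update_self, Pi.sub_apply, Pi.add_apply,
        update_of_ne (Fin.succ_ne_zero _), derivAlong_add_left, hy, Finset.sum_add_distrib]
      abel
    | succ m =>
      have h0 : ∀ C : VecField E X, update V m.succ C 0 = V 0 := fun C =>
        update_of_ne (Fin.succ_ne_zero m).symm _ _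
      have hd := (derivAlong_congr (V 0) (hT.add _ m A B ht hA hB)).trans
        (derivAlong_add (V 0) (hT.smooth _ (smoothNear_update ht m hA))
          (hT.smooth _ (smoothNear_update ht m hB)))
      have hs : (∑ l : Fin j, T (update (update (Fin.tail V) m (A + B)) l
            (covAlong conn (V 0) (update V m.succ (A + B) l.succ))))
          =ᶠ[𝓝 x] ∑ l : Fin j, (T (update (update (Fin.tail V) m A) l
            (covAlong conn (V 0) (update V m.succ A l.succ))) +
            T (update (update (Fin.tail V) m B) l
            (covAlong conn (V 0) (update V m.succ B l.succ)))) := by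
        refine eventuallyEq_finsetSum _ fun l _ => ?_
        by_cases hl : l = m
        · subst hl
          simp only [update_idem, update_self]
          refine (hT.congr _ _ (smoothNear_update ht l ((hV 0).covAlong (hA.add hB)))
            (smoothNear_update ht l (((hV 0).covAlong hA).add ((hV 0).covAlong hB)))
            fun q => ?_).trans (hT.add _ l _ _ ht ((hV 0).covAlong hA) ((hV 0).covAlong hB))
          by_cases hq : q = l
          · subst hq
            simpa using covAlong_add_right conn hA hB
          · simp [hq]
        · have hl' : l.succ ≠ m.succ := fun h => hl (Fin.succ_injective _ h)
          simp only [update_of_ne hl', update_comm (Ne.symm hl)]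
          exact hT.add _ m A B (smoothNear_update ht l ((hV 0).covAlong (hV l.succ))) hA hB
      filter_upwards [hs, hd] with y hy hy'
      simp only [_root_.covTensor, Fin.tail_update_succ, h0, Pi.sub_apply, Pi.add_apply, hy, hy',
        Finset.sum_add_distrib]
      abel
  smul V i φ A hV hφ hA := by
    have ht : ∀ i, SmoothFieldNear (Fin.tail V i) x := fun i => hV i.succ
    induction i using Fin.cases with
    | zero =>
      have hs : (∑ l : Fin j, T (update (Fin.tail V) l (covAlong conn (φ • A) (V l.succ))))
          =ᶠ[𝓝 x] ∑ l : Fin j, φ • T (update (Fin.tail V) l (covAlong conn A (V l.succ))) :=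
        eventuallyEq_finsetSum _ fun l _ => by
          rw [covAlong_smul_left]
          exact hT.smul _ l _ _ ht hφ (hA.covAlong (hV l.succ))
      filter_upwards [hs] with y hy
      simp only [_root_.covTensor, Fin.tail_update_zero, update_self, Pi.sub_apply, Pi.smul_apply',
        update_of_ne (Fin.succ_ne_zero _), derivAlong_smul_left, hy, Finset.sum_apply, smul_sub,
        Finset.smul_sum]
    | succ m =>
      have h0 : ∀ C : VecField E X, update V m.succ C 0 = V 0 := fun C =>
        update_of_ne (Fin.succ_ne_zero m).symm _ _
      have hTA := hT.smooth _ (smoothNear_update ht m hA)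
      have hdφ : SmoothNear (E := E) (F := ℝ) (derivAlong (V 0) φ) x := by
        filter_upwards [hV 0, hφ] with y h1 h2 using contMDiffAt_derivAlong h1 h2
      have hd := (derivAlong_congr (V 0) (hT.smul _ m φ A ht hφ hA)).trans
        (derivAlong_smul (V 0) hφ hTA)
      have hs : (∑ l : Fin j, T (update (update (Fin.tail V) m (φ • A)) l
            (covAlong conn (V 0) (update V m.succ (φ • A) l.succ))))
          =ᶠ[𝓝 x] ∑ l : Fin j, (φ • T (update (update (Fin.tail V) m A) l
            (covAlong conn (V 0) (update V m.succ A l.succ))) +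
            if l = m then derivAlong (V 0) φ • T (update (Fin.tail V) m A) else 0) := by
        refine eventuallyEq_finsetSum _ fun l _ => ?_
        by_cases hl : l = m
        · subst hl
          simp only [update_idem, update_self, if_true]
          have s1 : SmoothFieldNear (φ • _root_.covAlong conn (V 0) A) x :=
            SmoothFieldNear.smul hφ ((hV 0).covAlong hA)
          have s2 : SmoothFieldNear (derivAlong (V 0) φ • A) x := SmoothFieldNear.smul hdφ hA
          refine ((hT.congr _ _ (smoothNear_update ht l ((hV 0).covAlong (SmoothFieldNear.smul hφ hA)))
            (smoothNear_update ht l (s1.add s2))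
            fun q => ?_).trans (hT.add _ l _ _ ht s1 s2)).trans
            (EventuallyEq.add (hT.smul _ l _ _ ht hφ ((hV 0).covAlong hA))
              (hT.smul _ l _ _ ht hdφ hA))
          by_cases hq : q = l
          · subst hq
            simpa using covAlong_smul_right conn hφ hA
          · simp [hq]
        · have hl' : l.succ ≠ m.succ := fun h => hl (Fin.succ_injective _ h)
          simp only [update_of_ne hl', update_comm (Ne.symm hl), if_neg hl, add_zero]
          exact hT.smul _ m φ A (smoothNear_update ht l ((hV 0).covAlong (hV l.succ))) hφ hA
      filter_upwards [hs, hd] with y hy hy'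
      simp only [_root_.covTensor, Fin.tail_update_succ, h0, Pi.sub_apply, Pi.add_apply, hy, hy',
        Finset.sum_add_distrib, Finset.sum_ite_eq', Finset.mem_univ, if_true, Finset.sum_apply,
        ite_apply, Pi.zero_apply,
        Pi.smul_apply', smul_sub, Finset.smul_sum]
      abel

theorem IsTensorNear.sum {j : ℕ} {T : TensorOp E X W j} {x : X} (hT : IsTensorNear T x)
    {V : Fin j → VecField E X} (hV : ∀ i, SmoothFieldNear (V i) x) (i : Fin j) {ι : Type*}
    (s : Finset ι) (A : ι → VecField E X) (hA : ∀ l, SmoothFieldNear (A l) x) :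
    SmoothFieldNear (∑ l ∈ s, A l) x ∧
      T (update V i (∑ l ∈ s, A l)) x = ∑ l ∈ s, T (update V i (A l)) x := by
  classical
  have h0 : SmoothFieldNear (0 : VecField E X) x :=
    Eventually.of_forall fun y => (Bundle.contMDiff_zeroSection ℝ _).contMDiffAt
  induction s using Finset.induction_on with
  | empty =>
    refine ⟨by simpa using h0, ?_⟩
    have hz : SmoothNear (E := E) (F := ℝ) (fun _ : X => (0 : ℝ)) x :=
      Eventually.of_forall fun y => contMDiffAt_const
    have := (hT.smul V i (fun _ => 0) 0 hV hz h0).eq_of_nhds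
    have e : ((fun _ => 0 : X → ℝ) • (0 : VecField E X)) = 0 := by ext; simp
    rw [e] at this
    simpa using this
  | insert a s ha ih =>
    rw [Finset.sum_insert ha, Finset.sum_insert ha]
    refine ⟨(hA a).add ih.1, ?_⟩
    rw [(hT.add V i _ _ hV (hA a) ih.1).eq_of_nhds, Pi.add_apply, ih.2]

theorem IsTensorNear.value_update {j : ℕ} {T : TensorOp E X W j} {x : X} (hT : IsTensorNear T x)
    {V : Fin j → VecField E X} (hV : ∀ i, SmoothFieldNear (V i) x) (i : Fin j)
    {A B : VecField E X} (hA : SmoothFieldNear A x) (hB : SmoothFieldNear B x) (h : A x = B x) :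
    T (update V i A) x = T (update V i B) x := by
  let t := trivializationAt E (TangentSpace 𝓘(ℝ, E) : X → Type _) x
  have x_mem : x ∈ t.baseSet := FiberBundle.mem_baseSet_trivializationAt E _ x
  let b := Module.Basis.ofVectorSpace ℝ E
  let s := t.localFrame b
  let c := t.localFrameCoeff 𝓘(ℝ, E) b
  have hbase : ∀ᶠ y in 𝓝 x, y ∈ t.baseSet := t.open_baseSet.mem_nhds x_mem
  have hs : ∀ l, SmoothFieldNear (s l) x := fun l => by
    filter_upwards [hbase] with y hy using contMDiffAt_localFrame_of_mem ∞ _ b l hy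
  have hc : ∀ {A : VecField E X}, SmoothFieldNear A x → ∀ l,
      SmoothNear (E := E) (F := ℝ) (fun y => c l y (A y)) x := fun hA l => by
    filter_upwards [hbase, hA] with y hy hAy using contMDiffAt_localFrameCoeff b hy hAy l
  have key : ∀ {A : VecField E X}, SmoothFieldNear A x →
      T (update V i A) x = ∑ l, c l x (A x) • T (update V i (s l)) x := by
    intro A hA
    have hterm : ∀ l, SmoothFieldNear ((fun y => c l y (A y)) • s l) x :=
      fun l => SmoothFieldNear.smul (hc hA l) (hs l)
    obtain ⟨h1, h2⟩ := hT.sum hV i Finset.univ (fun l => (fun y => c l y (A y)) • s l) hterm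
    have h3 : T (update V i A) =ᶠ[𝓝 x]
        T (update V i (∑ l, (fun y => c l y (A y)) • s l)) := by
      refine hT.congr _ _ (smoothNear_update hV i hA) (smoothNear_update hV i h1) fun q => ?_
      by_cases hq : q = i
      · subst hq
        simp only [update_self]
        filter_upwards [t.eventually_eq_localFrame_sum_coeff_smul (I := 𝓘(ℝ, E)) (s := A) b x_mem]
          with y hy
        simpa using hy
      · simp [hq]
    rw [h3.eq_of_nhds, h2]
    exact Finset.sum_congr rfl fun l _ => (hT.smul V i _ _ hV (hc hA l) (hs l)).eq_of_nhds
  rw [key hA, key hB, h]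

/-- The value of a tensor field at `x` only depends on the values at `x` of its arguments. -/
theorem IsTensorNear.value_eq {j : ℕ} {T : TensorOp E X W j} {x : X} (hT : IsTensorNear T x)
    {V V' : Fin j → VecField E X} (hV : ∀ i, SmoothFieldNear (V i) x)
    (hV' : ∀ i, SmoothFieldNear (V' i) x) (h : ∀ i, V i x = V' i x) : T V x = T V' x := by
  have key : ∀ s : Finset (Fin j), T V x = T (fun i => if i ∈ s then V' i else V i) x := by
    intro s
    induction s using Finset.induction_on with
    | empty => simp
    | insert a s ha ih =>
      have hU : ∀ i, SmoothFieldNear ((fun i => if i ∈ s then V' i else V i) i) x := by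
        intro i
        by_cases hi : i ∈ s
        · simpa [hi] using hV' i
        · simpa [hi] using hV i
      have e1 : (fun i => if i ∈ s then V' i else V i) =
          update (fun i => if i ∈ s then V' i else V i) a (V a) := by
        rw [eq_comm, update_eq_self_iff]; simp [ha]
      have e2 : (fun i => if i ∈ insert a s then V' i else V i) =
          update (fun i => if i ∈ s then V' i else V i) a (V' a) := by
        funext i
        by_cases hi : i = a
        · subst hi; simp
        · simp [hi]
      rw [ih, e1, e2]
      exact hT.value_update hU a (hV a) (hV' a) (h a)
  simpa using key Finset.univ

/-- The value at `x` of a tensor field, as a multilinear map on the tangent space at `x`: extend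
the tangent vectors to smooth vector fields and evaluate. -/
noncomputable def IsTensorNear.valueAt {j : ℕ} {T : TensorOp E X W j} {x : X}
    (hT : IsTensorNear T x) : MultilinearMap ℝ (fun _ : Fin j => TangentSpace 𝓘(ℝ, E) x) W where
  toFun v := T (fun i => FiberBundle.extend E (v i)) x
  map_update_add' := by
    intro inst v i a b
    have hinst : inst = instDecidableEqFin j := Subsingleton.elim _ _
    subst hinst
    have hv : ∀ l, SmoothFieldNear (FiberBundle.extend E (v l)) x :=
      fun l => smoothFieldNear_extend (v l)
    have e : ∀ c, (fun l => (FiberBundle.extend E (update v i c l) : VecField E X)) =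
        update (fun l => FiberBundle.extend E (v l)) i (FiberBundle.extend E c) := fun c => by
      funext l
      by_cases hl : l = i
      · subst hl; simp
      · simp [hl]
    simp only [e]
    have h1 := smoothFieldNear_extend a
    have h2 := smoothFieldNear_extend b
    rw [← Pi.add_apply, ← (hT.add _ i _ _ hv h1 h2).eq_of_nhds]
    exact hT.value_update hv i (smoothFieldNear_extend _) (h1.add h2) (by simp)
  map_update_smul' := by
    intro inst v i c a
    have hinst : inst = instDecidableEqFin j := Subsingleton.elim _ _
    subst hinst
    have hv : ∀ l, SmoothFieldNear (FiberBundle.extend E (v l)) x :=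
      fun l => smoothFieldNear_extend (v l)
    have e : ∀ c, (fun l => (FiberBundle.extend E (update v i c l) : VecField E X)) =
        update (fun l => FiberBundle.extend E (v l)) i (FiberBundle.extend E c) := fun c => by
      funext l
      by_cases hl : l = i
      · subst hl; simp
      · simp [hl]
    simp only [e]
    have h1 := smoothFieldNear_extend a
    have hc : SmoothNear (E := E) (F := ℝ) (fun _ : X => c) x :=
      Eventually.of_forall fun y => contMDiffAt_const
    have := (hT.smul _ i (fun _ => c) _ hv hc h1).eq_of_nhds
    rw [Pi.smul_apply'] at this
    rw [← this]
    exact hT.value_update hv i (smoothFieldNear_extend _) (SmoothFieldNear.smul hc h1) (by simp)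

theorem IsTensorNear.valueAt_apply {j : ℕ} {T : TensorOp E X W j} {x : X}
    (hT : IsTensorNear T x) (V : Fin j → VecField E X) (hV : ∀ i, SmoothFieldNear (V i) x) :
    hT.valueAt (fun i => V i x) = T V x :=
  hT.value_eq (fun _ => smoothFieldNear_extend _) hV fun i => by simp

end Tower

section JetAlgebra
variable {E : Type*} [NormedAddCommGroup E] [NormedSpace ℝ E]
  {X : Type*} [TopologicalSpace X] [ChartedSpace E X]
  {F : Type*} [NormedAddCommGroup F] [NormedSpace ℝ F]
  {M : Type*} [TopologicalSpace M] [ChartedSpace F M]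
  {W : Type*} [NormedAddCommGroup W] [NormedSpace ℝ W]

theorem JetEq.mono {k m : ℕ} (hmk : m ≤ k) {x : X} {g h : X → M} (H : JetEq E F k x g h) :
    JetEq E F m x g h :=
  ⟨H.1, fun i hi => H.2 i (hi.trans hmk)⟩

theorem JetEq.sub {k : ℕ} {x : X} {f f' u u' : X → W}
    (H : JetEq E W k x f f') (H' : JetEq E W k x u u')
    (hf : ContMDiffAt 𝓘(ℝ, E) 𝓘(ℝ, W) ∞ f x) (hf' : ContMDiffAt 𝓘(ℝ, E) 𝓘(ℝ, W) ∞ f' x)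
    (hu : ContMDiffAt 𝓘(ℝ, E) 𝓘(ℝ, W) ∞ u x) (hu' : ContMDiffAt 𝓘(ℝ, E) 𝓘(ℝ, W) ∞ u' x) :
    JetEq E W k x (f - u) (f' - u') :=
  JetEq.map₂ H H' hf hf' hu hu' (Φ := fun p q => p - q)
    (contMDiffAt_fst.sub contMDiffAt_snd)

theorem JetEq.add {k : ℕ} {x : X} {f f' u u' : X → W}
    (H : JetEq E W k x f f') (H' : JetEq E W k x u u')
    (hf : ContMDiffAt 𝓘(ℝ, E) 𝓘(ℝ, W) ∞ f x) (hf' : ContMDiffAt 𝓘(ℝ, E) 𝓘(ℝ, W) ∞ f' x)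
    (hu : ContMDiffAt 𝓘(ℝ, E) 𝓘(ℝ, W) ∞ u x) (hu' : ContMDiffAt 𝓘(ℝ, E) 𝓘(ℝ, W) ∞ u' x) :
    JetEq E W k x (f + u) (f' + u') :=
  JetEq.map₂ H H' hf hf' hu hu' (Φ := fun p q => p + q)
    (contMDiffAt_fst.add contMDiffAt_snd)

theorem JetEq.sum {k : ℕ} {x : X} {ι : Type*} (s : Finset ι) {f f' : ι → X → W}
    (H : ∀ i, JetEq E W k x (f i) (f' i))
    (hf : ∀ i, ContMDiffAt 𝓘(ℝ, E) 𝓘(ℝ, W) ∞ (f i) x)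
    (hf' : ∀ i, ContMDiffAt 𝓘(ℝ, E) 𝓘(ℝ, W) ∞ (f' i) x) :
    (JetEq E W k x (∑ i ∈ s, f i) (∑ i ∈ s, f' i)) ∧
      ContMDiffAt 𝓘(ℝ, E) 𝓘(ℝ, W) ∞ (∑ i ∈ s, f i) x ∧
      ContMDiffAt 𝓘(ℝ, E) 𝓘(ℝ, W) ∞ (∑ i ∈ s, f' i) x := by
  classical
  induction s using Finset.induction_on with
  | empty => exact ⟨JetEq.refl _ _ _, contMDiffAt_const, contMDiffAt_const⟩
  | insert a s ha ih =>
    simp only [Finset.sum_insert ha]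
    exact ⟨(H a).add ih.1 (hf a) (hf' a) ih.2.1 ih.2.2, (hf a).add ih.2.1, (hf' a).add ih.2.2⟩

end JetAlgebra

section Xi
variable {E : Type*} [NormedAddCommGroup E] [NormedSpace ℝ E] [FiniteDimensional ℝ E]
  {X : Type*} [TopologicalSpace X] [T2Space X] [ChartedSpace E X] [IsManifold 𝓘(ℝ, E) ∞ X]
  {F : Type*} [NormedAddCommGroup F] [NormedSpace ℝ F]
  {G : Type*} [TopologicalSpace G] [ChartedSpace F G] [Group G] [LieGroup 𝓘(ℝ, F) ∞ G]

/-- The tensor fields `ξ⁽ʲ⁾` of a map `g : X → G`: `ξ⁽¹⁾` is the right logarithmic derivative of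
`g`, and `ξ⁽ʲ⁺¹⁾ = ∇ξ⁽ʲ⁾`. (There is no `ξ⁽⁰⁾`; its value here is a dummy.) -/
noncomputable def xiOp (conn : TangentConnection E X) (g : X → G) : ∀ j : ℕ, TensorOp E X F j
  | 0 => 0
  | 1 => fun V => rightLogDerivAlong (V 0) g
  | j + 2 => covTensor conn (xiOp conn g (j + 1))

theorem smoothNear_rightLogDerivAlong {V : VecField E X} {g : X → G} {x : X}
    (hV : SmoothFieldNear V x) (hg : SmoothNear (E := E) (F := F) g x) :
    SmoothNear (E := E) (F := F) (rightLogDerivAlong (F := F) V g) x := by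
  filter_upwards [hV, hg.eventually_nhds] with y h1 h2
  exact contMDiffAt_rightLogDerivAlong h1 h2

theorem isTensorNear_xiOp (conn : TangentConnection E X)
    [CovariantDerivative.ContMDiffCovariantDerivative conn ∞] {g : X → G} {x : X}
    (hg : SmoothNear (E := E) (F := F) g x) : ∀ j, IsTensorNear (xiOp (F := F) conn g j) x
  | 0 =>
    { smooth := fun _ _ => Eventually.of_forall fun _ => contMDiffAt_const
      congr := fun _ _ _ _ _ => EventuallyEq.rfl
      add := fun _ i => i.elim0
      smul := fun _ i => i.elim0 }
  | 1 =>
    { smooth := fun V hV => smoothNear_rightLogDerivAlong (hV 0) hg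
      congr := fun V V' _ _ h => by
        filter_upwards [h 0] with y hy
        exact congrArg (rightLogDeriv (F := F) g y) hy
      add := fun V i A B _ _ _ => by
        have hi : i = 0 := Subsingleton.elim _ _
        subst hi
        refine Eventually.of_forall fun y => ?_
        simp only [xiOp, update_self, rightLogDerivAlong, Pi.add_apply]
        exact map_add (rightLogDeriv (F := F) g y) _ _
      smul := fun V i φ A _ _ _ => by
        have hi : i = 0 := Subsingleton.elim _ _
        subst hi
        refine Eventually.of_forall fun y => ?_
        simp only [xiOp, update_self, rightLogDerivAlong, Pi.smul_apply']
        exact map_smul (rightLogDeriv (F := F) g y) _ _ }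
  | j + 2 => (isTensorNear_xiOp conn hg (j + 1)).covTensor conn

/-- The `m`-jet of `ξ⁽ʲ⁾` only depends on the `(j + m)`-jet of `g`. -/
theorem jetEq_xiOp (conn : TangentConnection E X)
    [CovariantDerivative.ContMDiffCovariantDerivative conn ∞] {g g' : X → G} {x : X}
    (hg : SmoothNear (E := E) (F := F) g x) (hg' : SmoothNear (E := E) (F := F) g' x) :
    ∀ (j m : ℕ), JetEq E F (j + m) x g g' → ∀ V : Fin j → VecField E X,
      (∀ i, SmoothFieldNear (V i) x) →
      JetEq E F m x (xiOp (F := F) conn g j V) (xiOp (F := F) conn g' j V)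
  | 0, _, _, _, _ => JetEq.refl _ _ _
  | 1, m, H, V, hV =>
    jetEq_rightLogDerivAlong (hV 0).self_of_nhds hg hg' (by rwa [Nat.add_comm] at H)
  | j + 2, m, H, V, hV => by
    have ht : ∀ i, SmoothFieldNear (Fin.tail V i) x := fun i => hV i.succ
    have T := isTensorNear_xiOp conn hg (j + 1)
    have T' := isTensorNear_xiOp conn hg' (j + 1)
    have hu : ∀ i : Fin (j + 1), ∀ l, SmoothFieldNear
        (update (Fin.tail V) i (covAlong conn (V 0) (V i.succ)) l) x := fun i =>
      smoothNear_update ht i ((hV 0).covAlong (hV i.succ))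
    have h1 := jetEq_xiOp conn hg hg' (j + 1) (m + 1)
      (by rwa [show j + 1 + (m + 1) = j + 2 + m by omega]) (Fin.tail V) ht
    have h2 := fun i => jetEq_xiOp conn hg hg' (j + 1) m
      (H.mono (by omega)) (update (Fin.tail V) i (covAlong conn (V 0) (V i.succ))) (hu i)
    have h3 := JetEq.sum Finset.univ h2 (fun i => (T.smooth _ (hu i)).self_of_nhds)
      (fun i => (T'.smooth _ (hu i)).self_of_nhds)
    have d := contMDiffAt_derivAlong (hV 0).self_of_nhds (T.smooth _ ht).self_of_nhds
    have d' := contMDiffAt_derivAlong (hV 0).self_of_nhds (T'.smooth _ ht).self_of_nhds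
    have h4 := jetEq_derivAlong (hV 0).self_of_nhds (T.smooth _ ht).self_of_nhds
      (T'.smooth _ ht).self_of_nhds h1
    exact h4.sub h3.1 d d' h3.2.1 h3.2.2

end Xi

section JetGroup
variable {E : Type*} [NormedAddCommGroup E] [NormedSpace ℝ E]
  {X : Type*} [TopologicalSpace X] [ChartedSpace E X]
  {F : Type*} [NormedAddCommGroup F] [NormedSpace ℝ F]
  {G : Type*} [TopologicalSpace G] [ChartedSpace F G]

/-- Local smooth maps `X → G` around `x`, represented by maps that are smooth near `x`. -/
structure LocalMap (E : Type*) [NormedAddCommGroup E] [NormedSpace ℝ E]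
    {X : Type*} [TopologicalSpace X] [ChartedSpace E X]
    (F : Type*) [NormedAddCommGroup F] [NormedSpace ℝ F]
    (G : Type*) [TopologicalSpace G] [ChartedSpace F G] (x : X) where
  /-- The underlying map; only its restriction to small neighbourhoods of `x` matters. -/
  toFun : X → G
  smooth : SmoothNear (E := E) (F := F) toFun x

/-- Having the same `k`-jet at `x`. -/
def jetSetoid (E : Type*) [NormedAddCommGroup E] [NormedSpace ℝ E]
    {X : Type*} [TopologicalSpace X] [ChartedSpace E X]
    (F : Type*) [NormedAddCommGroup F] [NormedSpace ℝ F]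
    (G : Type*) [TopologicalSpace G] [ChartedSpace F G] (k : ℕ) (x : X) :
    Setoid (LocalMap E F G x) where
  r a b := JetEq E F k x a.toFun b.toFun
  iseqv := ⟨fun _ => JetEq.refl _ _ _, fun h => h.symm, fun h h' => h.trans h'⟩

/-- The fibre over `x` of the `k`-th order jet bundle `Jᵏ(X, G) → X` of `X × G → X`. -/
def JetFiber (E : Type*) [NormedAddCommGroup E] [NormedSpace ℝ E]
    {X : Type*} [TopologicalSpace X] [ChartedSpace E X]
    (F : Type*) [NormedAddCommGroup F] [NormedSpace ℝ F]
    (G : Type*) [TopologicalSpace G] [ChartedSpace F G] (k : ℕ) (x : X) : Type _ :=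
  Quotient (jetSetoid E F G k x)

/-- The `k`-jet at `x` of a local map. -/
def LocalMap.jet {x : X} (a : LocalMap E F G x) (k : ℕ) : JetFiber E F G k x :=
  Quotient.mk _ a

variable [Group G] [LieGroup 𝓘(ℝ, F) ∞ G]

theorem JetEq.mul {k : ℕ} {x : X} {g g' h h' : X → G}
    (Hg : JetEq E F k x g g') (Hh : JetEq E F k x h h')
    (hg : ContMDiffAt 𝓘(ℝ, E) 𝓘(ℝ, F) ∞ g x) (hg' : ContMDiffAt 𝓘(ℝ, E) 𝓘(ℝ, F) ∞ g' x)
    (hh : ContMDiffAt 𝓘(ℝ, E) 𝓘(ℝ, F) ∞ h x) (hh' : ContMDiffAt 𝓘(ℝ, E) 𝓘(ℝ, F) ∞ h' x) :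
    JetEq E F k x (fun y => g y * h y) (fun y => g' y * h' y) :=
  haveI : IsManifold 𝓘(ℝ, F) ∞ G := LieGroup.toContMDiffMul.toIsManifold
  JetEq.map₂ Hg Hh hg hg' hh hh' (Φ := fun p q => p * q) (contMDiffAt_fst.mul contMDiffAt_snd)

theorem JetEq.inv {k : ℕ} {x : X} {g g' : X → G} (Hg : JetEq E F k x g g')
    (hg : ContMDiffAt 𝓘(ℝ, E) 𝓘(ℝ, F) ∞ g x) (hg' : ContMDiffAt 𝓘(ℝ, E) 𝓘(ℝ, F) ∞ g' x) :
    JetEq E F k x (fun y => (g y)⁻¹) (fun y => (g' y)⁻¹) :=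
  haveI : IsManifold 𝓘(ℝ, F) ∞ G := LieGroup.toContMDiffMul.toIsManifold
  JetEq.map₂ Hg Hg hg hg' hg hg' (Φ := fun p _ => p⁻¹) contMDiffAt_fst.inv

/-- The multiplication `(jᵏₓ g)(jᵏₓ h) = jᵏₓ(gh)` makes each fibre of `Jᵏ(X, G) → X` a group. The Lie
groupoid `Jᵏ(X, G) ⇉ X`, both of whose source and target maps are the projection to `X`, is the
bundle of these groups: two arrows compose if and only if they lie in the same fibre. -/
instance JetFiber.instGroup (k : ℕ) (x : X) : Group (JetFiber E F G k x) where
  mul := Quotient.map₂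
    (fun a b => ⟨fun y => a.toFun y * b.toFun y, by
      filter_upwards [a.smooth, b.smooth] with y h h' using h.mul h'⟩)
    (fun a a' ha b b' hb => JetEq.mul ha hb a.smooth.self_of_nhds a'.smooth.self_of_nhds
      b.smooth.self_of_nhds b'.smooth.self_of_nhds)
  one := Quotient.mk _ ⟨fun _ => 1, Eventually.of_forall fun _ => contMDiffAt_const⟩
  inv := Quotient.map
    (fun a => ⟨fun y => (a.toFun y)⁻¹, by filter_upwards [a.smooth] with y h using h.inv⟩)
    (fun a a' ha => JetEq.inv ha a.smooth.self_of_nhds a'.smooth.self_of_nhds)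
  mul_assoc := by
    rintro ⟨a⟩ ⟨b⟩ ⟨c⟩
    exact congrArg (Quotient.mk _) (by simp only [mul_assoc])
  one_mul := by
    rintro ⟨a⟩
    exact congrArg (Quotient.mk _) (by simp only [one_mul])
  mul_one := by
    rintro ⟨a⟩
    exact congrArg (Quotient.mk _) (by simp only [mul_one])
  inv_mul_cancel := by
    rintro ⟨a⟩
    exact congrArg (Quotient.mk _) (by simp only [inv_mul_cancel])

end JetGroup

section Trivialization
variable {E : Type*} [NormedAddCommGroup E] [NormedSpace ℝ E] [FiniteDimensional ℝ E]
  {X : Type*} [TopologicalSpace X] [T2Space X] [ChartedSpace E X] [IsManifold 𝓘(ℝ, E) ∞ X]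
  {F : Type*} [NormedAddCommGroup F] [NormedSpace ℝ F]
  {G : Type*} [TopologicalSpace G] [ChartedSpace F G] [Group G] [LieGroup 𝓘(ℝ, F) ∞ G]

/-- The fibre over `x` of `⨂ʲ T*X ⊗ 𝔤`, as the space of multilinear maps `(T_x X)ʲ → 𝔤`. -/
abbrev TensorFiber (E : Type*) [NormedAddCommGroup E] [NormedSpace ℝ E]
    {X : Type*} [TopologicalSpace X] [ChartedSpace E X]
    (F : Type*) [NormedAddCommGroup F] [NormedSpace ℝ F]
    (G : Type*) [TopologicalSpace G] [ChartedSpace F G] [Group G] (j : ℕ) (x : X) : Type _ :=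
  MultilinearMap ℝ (fun _ : Fin j => TangentSpace 𝓘(ℝ, E) x) (GroupLieAlgebra 𝓘(ℝ, F) G)

/-- The value at `x` of `ξ⁽ʲ⁾`, for a local map `g` around `x`. -/
noncomputable def LocalMap.xi (conn : TangentConnection E X)
    [CovariantDerivative.ContMDiffCovariantDerivative conn ∞] {x : X} (g : LocalMap E F G x)
    (j : ℕ) : TensorFiber E F G j x :=
  (isTensorNear_xiOp conn g.smooth j).valueAt

theorem LocalMap.xi_congr (conn : TangentConnection E X)
    [CovariantDerivative.ContMDiffCovariantDerivative conn ∞] {x : X} {g g' : LocalMap E F G x}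
    {j k : ℕ} (hj : j ≤ k) (H : JetEq E F k x g.toFun g'.toFun) : g.xi conn j = g'.xi conn j := by
  refine MultilinearMap.ext fun v => ?_
  exact (jetEq_xiOp conn g.smooth g'.smooth j 0 (H.mono hj) _
    fun i => smoothFieldNear_extend (v i)).1

/-- The fibre over `x` of `G × ⨁_{j=1}^k (⨂ʲ T*X ⊗ 𝔤)`. -/
abbrev TrivFiber (E : Type*) [NormedAddCommGroup E] [NormedSpace ℝ E]
    {X : Type*} [TopologicalSpace X] [ChartedSpace E X]
    (F : Type*) [NormedAddCommGroup F] [NormedSpace ℝ F]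
    (G : Type*) [TopologicalSpace G] [ChartedSpace F G] [Group G] (k : ℕ) (x : X) : Type _ :=
  G × ((j : Finset.Icc 1 k) → TensorFiber E F G j x)

/-- The right trivialization `jᵏₓ g ↦ (g(x), ξ⁽¹⁾(x), …, ξ⁽ᵏ⁾(x))` of `Jᵏ(X, G)` over `x`. -/
noncomputable def JetFiber.triv (conn : TangentConnection E X)
    [CovariantDerivative.ContMDiffCovariantDerivative conn ∞] {k : ℕ} {x : X} :
    JetFiber E F G k x → TrivFiber E F G k x :=
  Quotient.lift (fun g => (g.toFun x, fun j => g.xi conn j)) fun _ _ H =>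
    Prod.ext H.1 (funext fun j => LocalMap.xi_congr conn (Finset.mem_Icc.1 j.2).2 H)

end Trivialization

section LieAlgebra
variable {F : Type*} [NormedAddCommGroup F] [NormedSpace ℝ F]
  {G : Type*} [TopologicalSpace G] [ChartedSpace F G] [Group G]

/-- The adjoint representation: `Ad_g : 𝔤 → 𝔤` is the derivative at `1` of `h ↦ g h g⁻¹`. -/
noncomputable def adjointRep (F : Type*) [NormedAddCommGroup F] [NormedSpace ℝ F]
    {G : Type*} [TopologicalSpace G] [ChartedSpace F G] [Group G] (g : G) :
    GroupLieAlgebra 𝓘(ℝ, F) G →L[ℝ] GroupLieAlgebra 𝓘(ℝ, F) G :=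
  mfderiv 𝓘(ℝ, F) 𝓘(ℝ, F) (fun h : G => g * h * g⁻¹) 1

/-- `ad(X₁) ⋯ ad(X_{l-1})(X_l)` for a list `[X₁, …, X_l]` (and `0` for the empty list). -/
noncomputable def adList : List (GroupLieAlgebra 𝓘(ℝ, F) G) → GroupLieAlgebra 𝓘(ℝ, F) G
  | [] => 0
  | [X] => X
  | X :: Y :: L => ⁅X, adList (Y :: L)⁆

end LieAlgebra

/-! Write ξ for the right logarithmic derivative of g. Everything rests on one differentiation rule:
for a 𝔤-valued function η, U(Ad_{g⁻¹} η) = Ad_{g⁻¹}(Uη − [ξ⁽¹⁾(U), η]) (`mvfderiv_modelAd_inv`). It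
holds because the derivative of Ad at the unit is ad (`hasFDerivAt_chartAdjoint`) and because the
inverse of a curve through the unit has the opposite velocity (`mvfderiv_chart_inv`).

The formula for ω⁽ʲ⁾ then follows by induction on j, as an identity of tensor fields near x. For j =
1 it reads ω⁽¹⁾ = −Ad_{g⁻¹} ξ⁽¹⁾ (`rightLogDeriv_inv`). For the step, differentiate the term of a
partition λ of {1, …, j} along V₀. Differentiating Ad_{g⁻¹} puts −ad(ξ⁽¹⁾(V₀)) in front of the word:
this is the term, with its sign, of λ with the new block {0} added. Differentiating the i-th factor
by the Leibniz rule gives a word with ξ^{(j_i+1)}(V₀, …), the term of λ with 0 inserted into λ_i,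
together with terms in which some V_r is replaced by ∇_{V₀}V_r
(`derivAlong_bracketWord_blockValues`). The latter are exactly what the induced connection on
tensors subtracts.

Each partition of {0, …, j} arises once in this way (`sum_orderedFinpartition_succ`). As 0 is the
smallest element, inserting it into a block changes no maximum, and the block {0} comes first. This
is why ordering blocks by their maxima gives the correct order of the brackets. -/

/-! ### Second-order calculus of a local group: the derivative of Ad at the unit. -/

section LocalGroup
variable {F : Type*} [NormedAddCommGroup F] [NormedSpace ℝ F]

/-- The antisymmetrized mixed second derivative at `(p, p)` of `m : F × F → F`. -/
noncomputable def mixedBracket (m : F × F → F) (p v w : F) : F :=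
  fderiv ℝ (fderiv ℝ m) (p, p) (v, 0) (0, w) - fderiv ℝ (fderiv ℝ m) (p, p) (w, 0) (0, v)

theorem hasFDerivAt_partial_right {m : F × F → F} {p : F} (hm : ContDiffAt ℝ ∞ m (p, p)) :
    HasFDerivAt (fun q => (fderiv ℝ m (q, p)).comp (ContinuousLinearMap.inr ℝ F F))
      (((ContinuousLinearMap.compL ℝ F (F × F) F).flip (ContinuousLinearMap.inr ℝ F F)).comp
        ((fderiv ℝ (fderiv ℝ m) (p, p)).comp (ContinuousLinearMap.inl ℝ F F))) p := by
  have h1 : HasFDerivAt (fderiv ℝ m) (fderiv ℝ (fderiv ℝ m) (p, p)) (p, p) :=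
    ((hm.fderiv_right (m := ∞) (by simp)).differentiableAt (by simp)).hasFDerivAt
  have h2 : HasFDerivAt (fun q : F => (q, p)) (ContinuousLinearMap.inl ℝ F F) p :=
    (hasFDerivAt_id p).prodMk (hasFDerivAt_const p p)
  exact ((ContinuousLinearMap.compL ℝ F (F × F) F).flip
    (ContinuousLinearMap.inr ℝ F F)).hasFDerivAt.comp p
      (HasFDerivAt.comp (f := fun q : F => (q, p)) p h1 h2)

theorem hasFDerivAt_partial_left {m : F × F → F} {p : F} (hm : ContDiffAt ℝ ∞ m (p, p)) :
    HasFDerivAt (fun q => (fderiv ℝ m (p, q)).comp (ContinuousLinearMap.inl ℝ F F))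
      (((ContinuousLinearMap.compL ℝ F (F × F) F).flip (ContinuousLinearMap.inl ℝ F F)).comp
        ((fderiv ℝ (fderiv ℝ m) (p, p)).comp (ContinuousLinearMap.inr ℝ F F))) p := by
  have h1 : HasFDerivAt (fderiv ℝ m) (fderiv ℝ (fderiv ℝ m) (p, p)) (p, p) :=
    ((hm.fderiv_right (m := ∞) (by simp)).differentiableAt (by simp)).hasFDerivAt
  have h2 : HasFDerivAt (fun q : F => (p, q)) (ContinuousLinearMap.inr ℝ F F) p :=
    (hasFDerivAt_const p p).prodMk (hasFDerivAt_id p)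
  exact ((ContinuousLinearMap.compL ℝ F (F × F) F).flip
    (ContinuousLinearMap.inl ℝ F F)).hasFDerivAt.comp p (h1.comp p h2)

theorem eventually_differentiableAt {V W : Type*} [NormedAddCommGroup V] [NormedSpace ℝ V]
    [NormedAddCommGroup W] [NormedSpace ℝ W] {f : V → W} {a : V} (hf : ContDiffAt ℝ ∞ f a) :
    ∀ᶠ b in 𝓝 a, DifferentiableAt ℝ f b := by
  have : ContDiffAt ℝ 1 f a := hf.of_le (by exact_mod_cast le_top)
  filter_upwards [this.eventually (by simp)] with b hb using hb.differentiableAt (by simp)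

/-- Left translation by the unit is the identity, hence so is its differential. The lemma serves for
multiplication and for conjugation alike. -/
theorem fderiv_partial_right_self {m : F × F → F} {p : F} (hm : ContDiffAt ℝ ∞ m (p, p))
    (h : ∀ᶠ q in 𝓝 p, m (p, q) = q) :
    (fderiv ℝ m (p, p)).comp (ContinuousLinearMap.inr ℝ F F) = ContinuousLinearMap.id ℝ F := by
  have h1 : HasFDerivAt (fun q : F => m (p, q))
      ((fderiv ℝ m (p, p)).comp (ContinuousLinearMap.inr ℝ F F)) p :=
    (hm.differentiableAt (by simp)).hasFDerivAt.comp p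
      ((hasFDerivAt_const p p).prodMk (hasFDerivAt_id p))
  exact h1.unique ((hasFDerivAt_id p).congr_of_eventuallyEq h)

theorem fderiv_partial_left_self {m : F × F → F} {p : F} (hm : ContDiffAt ℝ ∞ m (p, p))
    (h : ∀ᶠ q in 𝓝 p, m (q, p) = q) :
    (fderiv ℝ m (p, p)).comp (ContinuousLinearMap.inl ℝ F F) = ContinuousLinearMap.id ℝ F := by
  have h1 : HasFDerivAt (fun q : F => m (q, p))
      ((fderiv ℝ m (p, p)).comp (ContinuousLinearMap.inl ℝ F F)) p :=
    HasFDerivAt.comp (f := fun q : F => (q, p)) p (hm.differentiableAt (by simp)).hasFDerivAt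
      ((hasFDerivAt_id p).prodMk (hasFDerivAt_const p p))
  exact h1.unique ((hasFDerivAt_id p).congr_of_eventuallyEq h)

/-- In a local group `m` with unit `p` and conjugation `c`, the derivative of the adjoint
representation is the bracket. -/
theorem hasFDerivAt_conj_apply {m c : F × F → F} {p : F} (hm : ContDiffAt ℝ ∞ m (p, p))
    (hc : ContDiffAt ℝ ∞ c (p, p)) (hr : ∀ᶠ q in 𝓝 p, m (q, p) = q) (hcp : ∀ᶠ q in 𝓝 p, c (q, p) = p)
    (hcq : ∀ᶠ q in 𝓝 p, c (p, q) = q)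
    (hmc : ∀ᶠ q in 𝓝 (p, p), m (c q, q.1) = m q) :
    DifferentiableAt ℝ (fun q => (fderiv ℝ c (q, p)).comp (ContinuousLinearMap.inr ℝ F F)) p ∧
      ∀ v w : F, fderiv ℝ (fun q => (fderiv ℝ c (q, p)).comp (ContinuousLinearMap.inr ℝ F F)) p v w
        = mixedBracket m p v w := by
  have hA := hasFDerivAt_partial_right hc
  have hL := hasFDerivAt_partial_right hm
  have hR := hasFDerivAt_partial_left hm
  refine ⟨hA.differentiableAt, fun v w => ?_⟩
  have t : Tendsto (fun q : F => (q, p)) (𝓝 p) (𝓝 (p, p)) :=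
    (continuous_id.prodMk continuous_const).tendsto p
  have t' : Tendsto (fun q : F => (p, q)) (𝓝 p) (𝓝 (p, p)) :=
    (continuous_const.prodMk continuous_id).tendsto p
  -- In group terms, dR_a ∘ Ad_a = dL_a at the unit: differentiate (aba⁻¹)a = ab in b at the unit.
  have hRA : ∀ᶠ q in 𝓝 p, ((fderiv ℝ m (p, q)).comp (ContinuousLinearMap.inl ℝ F F)).comp
      ((fderiv ℝ c (q, p)).comp (ContinuousLinearMap.inr ℝ F F)) =
      (fderiv ℝ m (q, p)).comp (ContinuousLinearMap.inr ℝ F F) := by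
    filter_upwards [t.eventually (eventually_differentiableAt hm),
      t'.eventually (eventually_differentiableAt hm),
      t.eventually (eventually_differentiableAt hc), hcp, t.eventually hmc.eventually_nhds]
      with q h1 h2 h3 h4 h5
    have e1 : HasFDerivAt (fun r : F => m (q, r))
        ((fderiv ℝ m (q, p)).comp (ContinuousLinearMap.inr ℝ F F)) p :=
      h1.hasFDerivAt.comp p ((hasFDerivAt_const q p).prodMk (hasFDerivAt_id p))
    have e2 : HasFDerivAt (fun r : F => c (q, r))
        ((fderiv ℝ c (q, p)).comp (ContinuousLinearMap.inr ℝ F F)) p :=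
      h3.hasFDerivAt.comp p ((hasFDerivAt_const q p).prodMk (hasFDerivAt_id p))
    have e3 : HasFDerivAt (fun r : F => m (r, q))
        ((fderiv ℝ m (p, q)).comp (ContinuousLinearMap.inl ℝ F F)) (c (q, p)) := by
      rw [h4]
      exact h2.hasFDerivAt.comp p ((hasFDerivAt_id p).prodMk (hasFDerivAt_const q p))
    refine (e3.comp p e2).unique (e1.congr_of_eventuallyEq ?_)
    have t2 : Tendsto (fun r : F => (q, r)) (𝓝 p) (𝓝 (q, p)) :=
      (continuous_const.prodMk continuous_id).tendsto p
    exact t2.eventually h5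
  -- Differentiate once more, now in a at the unit. There dR and Ad are both the identity, so the
  -- product rule gives D_v Ad = D_v dL − D_v dR.
  have hu := (hR.clm_comp hA).unique (hL.congr_of_eventuallyEq hRA)
  -- Symmetry of the second derivative turns the contribution of dR into the subtracted term of
  -- `mixedBracket`.
  have hs : IsSymmSndFDerivAt ℝ m (p, p) := hm.isSymmSndFDerivAt (by
    rw [minSmoothness_of_isRCLikeNormedField]; exact ENat.LEInfty.out)
  have := congrArg (fun T => T v w) hu
  simp only [fderiv_partial_left_self hm hr, fderiv_partial_right_self hc hcq] at this
  simp only [add_apply, ContinuousLinearMap.comp_apply, ContinuousLinearMap.inl_apply,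
    ContinuousLinearMap.flip_apply, ContinuousLinearMap.compL_apply, ContinuousLinearMap.id_comp,
    ContinuousLinearMap.inr_apply, ContinuousLinearMap.comp_id] at this
  rw [hA.fderiv]
  simp only [mixedBracket]
  rw [← this, hs.eq (w, 0) (0, v)]
  simp

end LocalGroup

/-! ### The Lie group read in the chart at the unit: Lie bracket and adjoint representation. -/

section ChartGroup
variable {F : Type*} [NormedAddCommGroup F] [NormedSpace ℝ F]
  {G : Type*} [TopologicalSpace G] [ChartedSpace F G] [Group G]

variable (F G) in
/-- The multiplication of `G` read in the chart at `1`. -/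
noncomputable def chartMul (q : F × F) : F :=
  extChartAt 𝓘(ℝ, F) (1 : G)
    ((extChartAt 𝓘(ℝ, F) (1 : G)).symm q.1 * (extChartAt 𝓘(ℝ, F) (1 : G)).symm q.2)

variable (F G) in
/-- The conjugation `(a, b) ↦ a b a⁻¹` of `G` read in the chart at `1`. -/
noncomputable def chartConj (q : F × F) : F :=
  extChartAt 𝓘(ℝ, F) (1 : G)
    ((extChartAt 𝓘(ℝ, F) (1 : G)).symm q.1 * (extChartAt 𝓘(ℝ, F) (1 : G)).symm q.2 *
      ((extChartAt 𝓘(ℝ, F) (1 : G)).symm q.1)⁻¹)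

variable (F G) in
/-- The unit of `G` read in the chart at `1`. -/
noncomputable def chartOne : F := extChartAt 𝓘(ℝ, F) (1 : G) 1

theorem chart_symm_chartOne : (extChartAt 𝓘(ℝ, F) (1 : G)).symm (chartOne F G) = 1 :=
  extChartAt_to_inv (I := 𝓘(ℝ, F)) (1 : G)

theorem eventually_mem_chart_target :
    ∀ᶠ q in 𝓝 (chartOne F G), q ∈ (extChartAt 𝓘(ℝ, F) (1 : G)).target :=
  extChartAt_target_mem_nhds (I := 𝓘(ℝ, F)) (1 : G)

/-- The tangent space at `1` is identified with `F` through the chart at `1` itself, so no change of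
coordinates enters. -/
theorem mvfderiv_one_eq_chart {W : Type*} [NormedAddCommGroup W] [NormedSpace ℝ W] {f : G → W}
    (hf : MDifferentiableAt 𝓘(ℝ, F) 𝓘(ℝ, W) f 1) (w : GroupLieAlgebra 𝓘(ℝ, F) G) :
    mvfderiv 𝓘(ℝ, F) f 1 w =
      fderiv ℝ (f ∘ (extChartAt 𝓘(ℝ, F) (1 : G)).symm) (chartOne F G) w := by
  have : mfderiv 𝓘(ℝ, F) 𝓘(ℝ, W) f 1 =
      fderiv ℝ (f ∘ (extChartAt 𝓘(ℝ, F) (1 : G)).symm) (chartOne F G) := by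
    rw [hf.mfderiv, ModelWithCorners.range_eq_univ, fderivWithin_univ]
    simp only [writtenInExtChartAt, extChartAt_model_space_eq_id, PartialEquiv.refl_coe,
      Function.id_comp]
    rfl
  exact congrArg (fun L => L w) this

theorem chartMul_chartOne_right :
    ∀ᶠ q in 𝓝 (chartOne F G), chartMul F G (q, chartOne F G) = q := by
  filter_upwards [eventually_mem_chart_target] with q hq
  simp only [chartMul, chart_symm_chartOne, mul_one]
  exact (extChartAt 𝓘(ℝ, F) (1 : G)).right_inv hq

theorem chartMul_chartOne_left :
    ∀ᶠ q in 𝓝 (chartOne F G), chartMul F G (chartOne F G, q) = q := by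
  filter_upwards [eventually_mem_chart_target] with q hq
  simp only [chartMul, chart_symm_chartOne, one_mul]
  exact (extChartAt 𝓘(ℝ, F) (1 : G)).right_inv hq

/-- Unlike the neighbouring identities, this one holds for every `q`: outside the chart target the
inverse chart still returns some group element, and any element conjugates the unit to itself. -/
theorem chartConj_chartOne_right (q : F) : chartConj F G (q, chartOne F G) = chartOne F G := by
  simp only [chartConj, chart_symm_chartOne, mul_one, mul_inv_cancel]
  rfl

theorem chartConj_chartOne_left :
    ∀ᶠ q in 𝓝 (chartOne F G), chartConj F G (chartOne F G, q) = q := by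
  filter_upwards [eventually_mem_chart_target] with q hq
  simp only [chartConj, chart_symm_chartOne, one_mul, inv_one, mul_one]
  exact (extChartAt 𝓘(ℝ, F) (1 : G)).right_inv hq

variable [LieGroup 𝓘(ℝ, F) ∞ G]

theorem contDiffAt_chartMul : ContDiffAt ℝ ∞ (chartMul F G) (chartOne F G, chartOne F G) := by
  have hm : ContMDiffAt (𝓘(ℝ, F).prod 𝓘(ℝ, F)) 𝓘(ℝ, F) ∞ (fun p : G × G => p.1 * p.2)
      (1, 1) := contMDiffAt_fst.mul contMDiffAt_snd
  have := (contMDiffAt_iff.1 hm).2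
  simp only [ModelWithCorners.range_eq_univ, contDiffWithinAt_univ, extChartAt_prod,
    PartialEquiv.prod_coe, PartialEquiv.prod_coe_symm, Function.comp_def, mul_one] at this
  exact this

theorem contDiffAt_chartConj : ContDiffAt ℝ ∞ (chartConj F G) (chartOne F G, chartOne F G) := by
  have hm : ContMDiffAt (𝓘(ℝ, F).prod 𝓘(ℝ, F)) 𝓘(ℝ, F) ∞ (fun p : G × G => p.1 * p.2 * p.1⁻¹)
      (1, 1) := (contMDiffAt_fst.mul contMDiffAt_snd).mul contMDiffAt_fst.inv
  have := (contMDiffAt_iff.1 hm).2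
  simp only [ModelWithCorners.range_eq_univ, contDiffWithinAt_univ, extChartAt_prod,
    PartialEquiv.prod_coe, PartialEquiv.prod_coe_symm, Function.comp_def, mul_one, inv_one] at this
  exact this

theorem continuousAt_chart_symm_prod :
    ContinuousAt (fun q : F × F => ((extChartAt 𝓘(ℝ, F) (1 : G)).symm q.1,
      (extChartAt 𝓘(ℝ, F) (1 : G)).symm q.2)) (chartOne F G, chartOne F G) := by
  have h : ContinuousAt (extChartAt 𝓘(ℝ, F) (1 : G)).symm (chartOne F G) :=
    continuousAt_extChartAt_symm (I := 𝓘(ℝ, F)) (1 : G)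
  exact (ContinuousAt.comp (f := Prod.fst) (x := (chartOne F G, chartOne F G)) h
    continuousAt_fst).prodMk (ContinuousAt.comp (f := Prod.snd)
      (x := (chartOne F G, chartOne F G)) h continuousAt_snd)

/-- The identity (aba⁻¹)a = ab survives in the chart as long as aba⁻¹ stays in the chart domain,
which continuity guarantees near the unit. -/
theorem chartMul_chartConj :
    ∀ᶠ q in 𝓝 (chartOne F G, chartOne F G),
      chartMul F G (chartConj F G q, q.1) = chartMul F G q := by
  have hm : ContMDiff (𝓘(ℝ, F).prod 𝓘(ℝ, F)) 𝓘(ℝ, F) ∞ (fun p : G × G => p.1 * p.2 * p.1⁻¹) :=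
    (contMDiff_fst.mul contMDiff_snd).mul contMDiff_fst.inv
  have hc : ContinuousAt (fun q : F × F => (extChartAt 𝓘(ℝ, F) (1 : G)).symm q.1 *
      (extChartAt 𝓘(ℝ, F) (1 : G)).symm q.2 * ((extChartAt 𝓘(ℝ, F) (1 : G)).symm q.1)⁻¹)
      (chartOne F G, chartOne F G) :=
    ContinuousAt.comp (f := fun q : F × F => ((extChartAt 𝓘(ℝ, F) (1 : G)).symm q.1,
      (extChartAt 𝓘(ℝ, F) (1 : G)).symm q.2)) hm.continuous.continuousAt
      continuousAt_chart_symm_prod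
  have := hc.eventually_mem (s := (extChartAt 𝓘(ℝ, F) (1 : G)).source) (by
    simpa only [chart_symm_chartOne, mul_one, inv_one] using
      extChartAt_source_mem_nhds (I := 𝓘(ℝ, F)) (1 : G))
  filter_upwards [this] with q hq
  simp only [chartMul, chartConj]
  rw [(extChartAt 𝓘(ℝ, F) (1 : G)).left_inv hq, inv_mul_cancel_right]

/-- The differential of left multiplication, read in the chart at `1`. -/
theorem mpullback_mulInvariantVectorField_chart (w : GroupLieAlgebra 𝓘(ℝ, F) G) :
    VectorField.mpullbackWithin 𝓘(ℝ, F) 𝓘(ℝ, F) (extChartAt 𝓘(ℝ, F) (1 : G)).symm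
      (mulInvariantVectorField w) univ =ᶠ[𝓝 (chartOne F G)] fun q =>
      (fderiv ℝ (chartMul F G) (q, chartOne F G)) ((0 : F), (w : F)) := by
  have : IsManifold 𝓘(ℝ, F) ∞ G := LieGroup.toContMDiffMul.toIsManifold
  have : IsManifold 𝓘(ℝ, F) 1 G := IsManifold.of_le (n := ∞) (by exact_mod_cast le_top)
  have t : Tendsto (fun q : F => (q, chartOne F G)) (𝓝 (chartOne F G))
      (𝓝 (chartOne F G, chartOne F G)) := (continuous_id.prodMk continuous_const).tendsto _
  filter_upwards [eventually_mem_chart_target,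
    t.eventually (eventually_differentiableAt contDiffAt_chartMul)] with q hq hd
  set h : G := (extChartAt 𝓘(ℝ, F) (1 : G)).symm q with hh
  have hs : h ∈ (extChartAt 𝓘(ℝ, F) (1 : G)).source := (extChartAt 𝓘(ℝ, F) (1 : G)).map_target hq
  have hs' : h ∈ (chartAt F (1 : G)).source := by simpa using hs
  -- The pullback applies the inverse of the differential of the inverse chart, that is, the
  -- differential of the chart.
  have hinv : (mfderivWithin 𝓘(ℝ, F) 𝓘(ℝ, F) (extChartAt 𝓘(ℝ, F) (1 : G)).symm univ q).inverse =
      mfderiv 𝓘(ℝ, F) 𝓘(ℝ, F) (extChartAt 𝓘(ℝ, F) (1 : G)) h := by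
    have a1 := mfderiv_extChartAt_comp_mfderivWithin_extChartAt_symm (I := 𝓘(ℝ, F)) hq
    have a2 := mfderivWithin_extChartAt_symm_comp_mfderiv_extChartAt (I := 𝓘(ℝ, F)) hq
    rw [ModelWithCorners.range_eq_univ] at a1 a2
    exact ContinuousLinearMap.inverse_eq a2 a1
  have hL : MDifferentiableAt 𝓘(ℝ, F) 𝓘(ℝ, F) (fun z : G => h * z) 1 :=
    (contMDiffAt_const.mul contMDiffAt_id : ContMDiffAt 𝓘(ℝ, F) 𝓘(ℝ, F) ∞
      (fun z : G => h * z) 1).mdifferentiableAt (by simp)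
  have hφ : MDifferentiableAt 𝓘(ℝ, F) 𝓘(ℝ, F) (extChartAt 𝓘(ℝ, F) (1 : G)) (h * 1) :=
    mdifferentiableAt_extChartAt (by simpa using hs')
  have e1 := mfderiv_comp (1 : G) hφ hL
  have e2 := mvfderiv_one_eq_chart (hφ.comp (1 : G) hL) w
  have e3 : HasFDerivAt (fun r : F => chartMul F G (q, r))
      ((fderiv ℝ (chartMul F G) (q, chartOne F G)).comp (ContinuousLinearMap.inr ℝ F F))
      (chartOne F G) :=
    hd.hasFDerivAt.comp _ ((hasFDerivAt_const _ _).prodMk (hasFDerivAt_id _))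
  have e4 : (extChartAt 𝓘(ℝ, F) (1 : G)) ∘ (fun z : G => h * z) ∘
      (extChartAt 𝓘(ℝ, F) (1 : G)).symm = fun r : F => chartMul F G (q, r) := rfl
  rw [Function.comp_assoc, e4, e3.fderiv] at e2
  rw [VectorField.mpullbackWithin_apply, hinv]
  -- The base points `h * 1` and `h` are only propositionally equal and tangent spaces depend on
  -- them, so the equality is eliminated over a variable point.
  have e5 : ∀ z : G, z = h → ∀ u : F, (mfderiv 𝓘(ℝ, F) 𝓘(ℝ, F) (extChartAt 𝓘(ℝ, F) (1 : G)) h :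
      F → F) u = (mfderiv 𝓘(ℝ, F) 𝓘(ℝ, F) (extChartAt 𝓘(ℝ, F) (1 : G)) z : F → F) u := by
    rintro z rfl u
    rfl
  refine (e5 (h * 1) (mul_one h) _).trans (Eq.trans ?_ e2)
  exact (congrArg (fun L => L w) e1).symm

/-- In the chart, the left-invariant field of w is q ↦ ∂₂m(q, p)w, with value w at the unit p. Its
derivative at p along v is the mixed second derivative of m, and the bracket of two such fields
antisymmetrizes it. -/
theorem bracket_eq_mixedBracket (v w : GroupLieAlgebra 𝓘(ℝ, F) G) :
    ⁅v, w⁆ = mixedBracket (chartMul F G) (chartOne F G) v w := by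
  have : IsManifold 𝓘(ℝ, F) ∞ G := LieGroup.toContMDiffMul.toIsManifold
  have : IsManifold 𝓘(ℝ, F) 1 G := IsManifold.of_le (n := ∞) (by exact_mod_cast le_top)
  -- Only the values of the derivative matter below, so its explicit expression is hidden behind
  -- `D`.
  obtain ⟨D, hD, hD'⟩ : ∃ D : F →L[ℝ] F →L[ℝ] F, HasFDerivAt
      (fun q => (fderiv ℝ (chartMul F G) (q, chartOne F G)).comp (ContinuousLinearMap.inr ℝ F F)) D
      (chartOne F G) ∧ ∀ a b, D a b = fderiv ℝ (fderiv ℝ (chartMul F G))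
        (chartOne F G, chartOne F G) (a, 0) (0, b) :=
    ⟨_, hasFDerivAt_partial_right contDiffAt_chartMul, fun _ _ => rfl⟩
  have key : ∀ w : F, HasFDerivAt (fun q => (fderiv ℝ (chartMul F G) (q, chartOne F G)) (0, w))
      (D.flip w) (chartOne F G) := fun w =>
    (ContinuousLinearMap.apply ℝ F w).hasFDerivAt.comp (chartOne F G) hD
  have val : ∀ w : F,
      (fderiv ℝ (chartMul F G) (chartOne F G, chartOne F G)) (0, w) = w := fun w =>
    congrArg (fun L : F →L[ℝ] F => L w)
      (fderiv_partial_right_self contDiffAt_chartMul chartMul_chartOne_left)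
  have h1 : ∀ u : F,
      (mfderiv 𝓘(ℝ, F) 𝓘(ℝ, F) (extChartAt 𝓘(ℝ, F) (1 : G)) 1).inverse u = u := by
    intro u
    rw [mfderiv_extChartAt_self]
    exact congrArg (fun L : F →L[ℝ] F => L u) ContinuousLinearMap.inverse_id
  rw [GroupLieAlgebra.bracket_def, ← VectorField.mlieBracketWithin_univ,
    VectorField.mlieBracketWithin_apply, ModelWithCorners.range_eq_univ]
  simp only [preimage_univ, univ_inter]
  -- The bracket on the manifold is the bracket in the chart, carried back by the inverse
  -- differential of the chart, which is the identity at `1`.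
  refine (h1 _).trans ?_
  refine (congrFun (VectorField.lieBracketWithin_univ (𝕜 := ℝ) (E := F)) _).trans ?_
  have ev := mpullback_mulInvariantVectorField_chart (F := F) (G := G)
  refine (Filter.EventuallyEq.lieBracket_vectorField_eq (𝕜 := ℝ) (ev v) (ev w)).trans ?_
  rw [VectorField.lieBracket, (key w).fderiv, (key v).fderiv]
  refine (congrArg₂ (fun a b : F => D.flip w a - D.flip v b) (val v) (val w)).trans ?_
  exact congrArg₂ (fun a b : F => a - b) (hD' v w) (hD' w v)

/-- At `1` the chart there has identity differential, so velocities at the unit may be computed with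
`F`-valued functions. -/
theorem mvfderiv_chart_one {E : Type*} [NormedAddCommGroup E] [NormedSpace ℝ E]
    {X : Type*} [TopologicalSpace X] [ChartedSpace E X] {u : X → G} {y : X} (hu1 : u y = 1)
    (hu : MDifferentiableAt 𝓘(ℝ, E) 𝓘(ℝ, F) u y) (v : TangentSpace 𝓘(ℝ, E) y) :
    (mfderiv 𝓘(ℝ, E) 𝓘(ℝ, F) u y v : F) =
      mvfderiv 𝓘(ℝ, E) (fun z => extChartAt 𝓘(ℝ, F) (1 : G) (u z)) y v := by
  have : IsManifold 𝓘(ℝ, F) ∞ G := LieGroup.toContMDiffMul.toIsManifold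
  have : IsManifold 𝓘(ℝ, F) 1 G := IsManifold.of_le (n := ∞) (by exact_mod_cast le_top)
  have hρ : MDifferentiableAt 𝓘(ℝ, F) 𝓘(ℝ, F) (extChartAt 𝓘(ℝ, F) (1 : G)) (u y) := by
    rw [hu1]; exact mdifferentiableAt_extChartAt (by simp)
  have e : mfderiv 𝓘(ℝ, E) 𝓘(ℝ, F) (fun z => extChartAt 𝓘(ℝ, F) (1 : G) (u z)) y v =
      mfderiv 𝓘(ℝ, F) 𝓘(ℝ, F) (extChartAt 𝓘(ℝ, F) (1 : G)) (u y)
        (mfderiv 𝓘(ℝ, E) 𝓘(ℝ, F) u y v) :=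
    congrArg (fun L => L v) (mfderiv_comp y hρ hu)
  -- `u y = 1` is not definitional; the variable `q` allows the substitution.
  have id1 : ∀ q : G, q = 1 → ∀ w : F,
      w = (mfderiv 𝓘(ℝ, F) 𝓘(ℝ, F) (extChartAt 𝓘(ℝ, F) (1 : G)) q : F → F) w := by
    rintro q rfl w
    exact (congrArg (fun L => L w) (mfderiv_extChartAt_self (I := 𝓘(ℝ, F)) (x := (1 : G)))).symm
  exact (id1 _ hu1 _).trans e.symm

theorem mdifferentiableAt_conj (g h : G) :
    MDifferentiableAt 𝓘(ℝ, F) 𝓘(ℝ, F) (fun z : G => g * z * g⁻¹) h :=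
  ((contMDiffAt_const.mul contMDiffAt_id).mul contMDiffAt_const : ContMDiffAt 𝓘(ℝ, F) 𝓘(ℝ, F) ∞
    (fun z : G => g * z * g⁻¹) h).mdifferentiableAt (by simp)

/-- The adjoint representation maps velocities at `1` to velocities of the conjugated map. -/
theorem adjointRep_mvfderiv_chart {E : Type*} [NormedAddCommGroup E] [NormedSpace ℝ E]
    {X : Type*} [TopologicalSpace X] [ChartedSpace E X] {u : X → G} {y : X} (hu1 : u y = 1)
    (hu : MDifferentiableAt 𝓘(ℝ, E) 𝓘(ℝ, F) u y) (g : G) (v : TangentSpace 𝓘(ℝ, E) y) :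
    adjointRep F g (mvfderiv 𝓘(ℝ, E) (fun z => extChartAt 𝓘(ℝ, F) (1 : G) (u z)) y v) =
      mvfderiv 𝓘(ℝ, E) (fun z => extChartAt 𝓘(ℝ, F) (1 : G) (g * u z * g⁻¹)) y v := by
  have hc := (mdifferentiableAt_conj (F := F) g (u y)).comp y hu
  rw [← mvfderiv_chart_one hu1 hu]
  refine Eq.trans ?_ (mvfderiv_chart_one (u := fun z => g * u z * g⁻¹) (by simp [hu1]) hc v)
  have e := mfderiv_comp y (mdifferentiableAt_conj (F := F) g (u y)) hu
  have id1 : ∀ q : G, q = 1 → ∀ w : F, (adjointRep F g : F → F) w =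
      (mfderiv 𝓘(ℝ, F) 𝓘(ℝ, F) (fun z : G => g * z * g⁻¹) q : F → F) w := by
    rintro q rfl w
    rfl
  exact (id1 _ hu1 _).trans (congrArg (fun L => L v) e).symm

theorem mvfderiv_chart_self (w : GroupLieAlgebra 𝓘(ℝ, F) G) :
    mvfderiv 𝓘(ℝ, F) (fun z : G => extChartAt 𝓘(ℝ, F) (1 : G) z) 1 w = w :=
  ((mvfderiv_chart_one (u := fun z : G => z) rfl mdifferentiableAt_id w).symm.trans
    (congrArg (fun L => L w) (mfderiv_id (I := 𝓘(ℝ, F)) (x := (1 : G)))) : _)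

theorem adjointRep_eq_mvfderiv (g : G) (w : GroupLieAlgebra 𝓘(ℝ, F) G) :
    adjointRep F g w =
      mvfderiv 𝓘(ℝ, F) (fun z : G => extChartAt 𝓘(ℝ, F) (1 : G) (g * z * g⁻¹)) 1 w := by
  have := adjointRep_mvfderiv_chart (u := fun z : G => z) rfl mdifferentiableAt_id g w
  rwa [mvfderiv_chart_self] at this

/-- Conjugation by `g * h` is the composite of two conjugations fixing the unit; this is the chain
rule. -/
theorem adjointRep_mul (g h : G) (w : GroupLieAlgebra 𝓘(ℝ, F) G) :
    adjointRep F (g * h) w = adjointRep F g (adjointRep F h w) := by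
  rw [adjointRep_eq_mvfderiv h, adjointRep_mvfderiv_chart (u := fun z : G => h * z * h⁻¹)
    (by simp) (mdifferentiableAt_conj h 1), adjointRep_eq_mvfderiv]
  simp only [mul_inv_rev, mul_assoc]
  rfl

/-- The adjoint representation, read in the chart at `1`. -/
noncomputable def chartAdjoint (F : Type*) [NormedAddCommGroup F] [NormedSpace ℝ F]
    (G : Type*) [TopologicalSpace G] [ChartedSpace F G] [Group G] (q : F) : F →L[ℝ] F :=
  (fderiv ℝ (chartConj F G) (q, chartOne F G)).comp (ContinuousLinearMap.inr ℝ F F)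

/-- Replaces Ad near the unit by a map between normed spaces, which can be differentiated in the
group variable. -/
theorem chartAdjoint_eq :
    ∀ᶠ q in 𝓝 (chartOne F G), ∀ w : GroupLieAlgebra 𝓘(ℝ, F) G,
      adjointRep F ((extChartAt 𝓘(ℝ, F) (1 : G)).symm q) w = chartAdjoint F G q w := by
  have : IsManifold 𝓘(ℝ, F) ∞ G := LieGroup.toContMDiffMul.toIsManifold
  have : IsManifold 𝓘(ℝ, F) 1 G := IsManifold.of_le (n := ∞) (by exact_mod_cast le_top)
  have t : Tendsto (fun q : F => (q, chartOne F G)) (𝓝 (chartOne F G))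
      (𝓝 (chartOne F G, chartOne F G)) := (continuous_id.prodMk continuous_const).tendsto _
  filter_upwards [t.eventually (eventually_differentiableAt contDiffAt_chartConj)] with q hd w
  have hφ : MDifferentiableAt 𝓘(ℝ, F) 𝓘(ℝ, F) (fun z : G => extChartAt 𝓘(ℝ, F) (1 : G)
      ((extChartAt 𝓘(ℝ, F) (1 : G)).symm q * z * ((extChartAt 𝓘(ℝ, F) (1 : G)).symm q)⁻¹)) 1 :=
    MDifferentiableAt.comp (1 : G) (mdifferentiableAt_extChartAt (by simp))
      (mdifferentiableAt_conj _ 1)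
  have e3 : HasFDerivAt (fun r : F => chartConj F G (q, r)) (chartAdjoint F G q)
      (chartOne F G) :=
    hd.hasFDerivAt.comp _ ((hasFDerivAt_const _ _).prodMk (hasFDerivAt_id _))
  rw [adjointRep_eq_mvfderiv, mvfderiv_one_eq_chart hφ]
  exact congrArg (fun L => L w) e3.fderiv

/-- The classical fact that the differential of Ad at the unit is ad, obtained from the local group
computation and the chart expression of the bracket. -/
theorem hasFDerivAt_chartAdjoint :
    DifferentiableAt ℝ (chartAdjoint F G) (chartOne F G) ∧
      ∀ v w : GroupLieAlgebra 𝓘(ℝ, F) G,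
        fderiv ℝ (chartAdjoint F G) (chartOne F G) v w = ⁅v, w⁆ := by
  have := hasFDerivAt_conj_apply (contDiffAt_chartMul (F := F) (G := G)) contDiffAt_chartConj
    chartMul_chartOne_right (Eventually.of_forall chartConj_chartOne_right)
    chartConj_chartOne_left chartMul_chartConj
  exact ⟨this.1, fun v w => (this.2 v w).trans (bracket_eq_mixedBracket v w).symm⟩

end ChartGroup

/-! ### Differentiation rules for vector-valued functions on a manifold. -/

section VectorValued
variable {E : Type*} [NormedAddCommGroup E] [NormedSpace ℝ E]
  {X : Type*} [TopologicalSpace X] [ChartedSpace E X]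
  {V W : Type*} [NormedAddCommGroup V] [NormedSpace ℝ V]
  [NormedAddCommGroup W] [NormedSpace ℝ W]

theorem mvfderiv_comp_hasFDerivAt {Φ : V → W} {Φ' : V →L[ℝ] W} {f : X → V} {y : X}
    (hΦ : HasFDerivAt Φ Φ' (f y)) (hf : MDifferentiableAt 𝓘(ℝ, E) 𝓘(ℝ, V) f y) :
    MDifferentiableAt 𝓘(ℝ, E) 𝓘(ℝ, W) (fun z => Φ (f z)) y ∧
      ∀ v, mvfderiv 𝓘(ℝ, E) (fun z => Φ (f z)) y v = Φ' (mvfderiv 𝓘(ℝ, E) f y v) := by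
  have h := hΦ.hasMFDerivAt.comp y hf.hasMFDerivAt
  exact ⟨h.mdifferentiableAt, fun v => congrArg (fun L => L v) h.mfderiv⟩

theorem mvfderiv_congr {f f' : X → V} {y : X} (h : f =ᶠ[𝓝 y] f') (v : TangentSpace 𝓘(ℝ, E) y) :
    mvfderiv 𝓘(ℝ, E) f y v = mvfderiv 𝓘(ℝ, E) f' y v := by
  simp only [mvfderiv, h.mfderiv_eq]
  rfl

theorem mvfderiv_prodMk {f : X → V} {h : X → W} {y : X}
    (hf : MDifferentiableAt 𝓘(ℝ, E) 𝓘(ℝ, V) f y) (hh : MDifferentiableAt 𝓘(ℝ, E) 𝓘(ℝ, W) h y)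
    (v : TangentSpace 𝓘(ℝ, E) y) :
    mvfderiv 𝓘(ℝ, E) (fun z => (f z, h z)) y v =
      (mvfderiv 𝓘(ℝ, E) f y v, mvfderiv 𝓘(ℝ, E) h y v) := by
  have hd := hf.prodMk_space hh
  refine Prod.ext ?_ ?_
  · exact ((mvfderiv_comp_hasFDerivAt hasFDerivAt_fst hd).2 v).symm
  · exact ((mvfderiv_comp_hasFDerivAt hasFDerivAt_snd hd).2 v).symm

theorem mvfderiv_pi {ι : Type*} [Fintype ι] {f : ι → X → V} {y : X}
    (hf : ∀ i, MDifferentiableAt 𝓘(ℝ, E) 𝓘(ℝ, V) (f i) y) (v : TangentSpace 𝓘(ℝ, E) y) :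
    MDifferentiableAt 𝓘(ℝ, E) 𝓘(ℝ, ι → V) (fun z i => f i z) y ∧
    mvfderiv 𝓘(ℝ, E) (fun z i => f i z) y v = fun i => mvfderiv 𝓘(ℝ, E) (f i) y v := by
  have hd : MDifferentiableAt 𝓘(ℝ, E) 𝓘(ℝ, ι → V) (fun z i => f i z) y :=
    mdifferentiableAt_iff _ _ |>.2 ⟨continuousAt_pi.2 fun i => (hf i).continuousAt,
      differentiableWithinAt_pi.2 fun i => ((mdifferentiableAt_iff _ _).1 (hf i)).2⟩
  refine ⟨hd, funext fun i => ?_⟩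
  exact ((mvfderiv_comp_hasFDerivAt (Φ := fun u : ι → V => u i)
    (ContinuousLinearMap.proj (R := ℝ) (φ := fun _ : ι => V) i).hasFDerivAt hd).2 v).symm

end VectorValued

/-! ### Derivatives of g⁻¹ and of Ad_{g⁻¹} along a map g. -/

section AdjointDerivative
variable {E : Type*} [NormedAddCommGroup E] [NormedSpace ℝ E]
  {X : Type*} [TopologicalSpace X] [ChartedSpace E X]
  {F : Type*} [NormedAddCommGroup F] [NormedSpace ℝ F]
  {G : Type*} [TopologicalSpace G] [ChartedSpace F G] [Group G]

/-- The adjoint representation on the model space of the Lie algebra. -/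
noncomputable def modelAd (F : Type*) [NormedAddCommGroup F] [NormedSpace ℝ F]
    {G : Type*} [TopologicalSpace G] [ChartedSpace F G] [Group G] (g : G) : F →L[ℝ] F :=
  adjointRep F g

/-- The bracket on the model space of the Lie algebra, as a continuous bilinear map. -/
noncomputable def modelBracket (F : Type*) [NormedAddCommGroup F] [NormedSpace ℝ F]
    (G : Type*) [TopologicalSpace G] [ChartedSpace F G] [Group G] : F →L[ℝ] F →L[ℝ] F :=
  fderiv ℝ (chartAdjoint F G) (chartOne F G)

variable [LieGroup 𝓘(ℝ, F) ∞ G]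

/-- Since `modelBracket` is by definition the derivative of Ad, its continuity comes for free; this
lemma identifies it with the Lie bracket. -/
theorem modelBracket_eq (v w : GroupLieAlgebra 𝓘(ℝ, F) G) : modelBracket F G v w = ⁅v, w⁆ :=
  hasFDerivAt_chartAdjoint.2 v w

theorem mdifferentiableAt_chart_one {u : X → G} {y : X} (hu1 : u y = 1)
    (hu : ContMDiffAt 𝓘(ℝ, E) 𝓘(ℝ, F) ∞ u y) :
    MDifferentiableAt 𝓘(ℝ, E) 𝓘(ℝ, F) (fun z => extChartAt 𝓘(ℝ, F) (1 : G) (u z)) y := by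
  have : IsManifold 𝓘(ℝ, F) ∞ G := LieGroup.toContMDiffMul.toIsManifold
  have : IsManifold 𝓘(ℝ, F) 1 G := IsManifold.of_le (n := ∞) (by exact_mod_cast le_top)
  exact MDifferentiableAt.comp y (mdifferentiableAt_extChartAt (by simp [hu1]))
    (hu.mdifferentiableAt (by simp))

/-- Differentiate u u⁻¹ = 1: at the unit, the multiplication has differential (a, b) ↦ a + b. -/
theorem mvfderiv_chart_inv {u : X → G} {y : X} (hu1 : u y = 1)
    (hu : ContMDiffAt 𝓘(ℝ, E) 𝓘(ℝ, F) ∞ u y) (v : TangentSpace 𝓘(ℝ, E) y) :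
    mvfderiv 𝓘(ℝ, E) (fun z => extChartAt 𝓘(ℝ, F) (1 : G) (u z)⁻¹) y v =
      -mvfderiv 𝓘(ℝ, E) (fun z => extChartAt 𝓘(ℝ, F) (1 : G) (u z)) y v := by
  have d1 := mdifferentiableAt_chart_one hu1 hu
  have d2 := mdifferentiableAt_chart_one (u := fun z => (u z)⁻¹) (by simp [hu1]) hu.inv
  have d := d1.prodMk_space d2
  have hm : HasFDerivAt (chartMul F G) (fderiv ℝ (chartMul F G) (chartOne F G, chartOne F G))
      (extChartAt 𝓘(ℝ, F) (1 : G) (u y), extChartAt 𝓘(ℝ, F) (1 : G) (u y)⁻¹) := by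
    rw [hu1, inv_one]
    exact (contDiffAt_chartMul.differentiableAt (by simp)).hasFDerivAt
  have h1 := (mvfderiv_comp_hasFDerivAt (f := fun z => (extChartAt 𝓘(ℝ, F) (1 : G) (u z),
    extChartAt 𝓘(ℝ, F) (1 : G) (u z)⁻¹)) hm d).2 v
  have hs : ∀ {w : X → G}, w y = 1 → ContinuousAt w y →
      ∀ᶠ z in 𝓝 y, w z ∈ (extChartAt 𝓘(ℝ, F) (1 : G)).source := fun h1 hw =>
    hw.eventually_mem (by rw [h1]; exact extChartAt_source_mem_nhds (I := 𝓘(ℝ, F)) (1 : G))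
  have ev : (fun z => chartMul F G (extChartAt 𝓘(ℝ, F) (1 : G) (u z),
      extChartAt 𝓘(ℝ, F) (1 : G) (u z)⁻¹)) =ᶠ[𝓝 y] fun _ => chartOne F G := by
    filter_upwards [hs hu1 hu.continuousAt,
      hs (w := fun z => (u z)⁻¹) (by simp [hu1]) hu.inv.continuousAt] with z h1 h2
    simp only [chartMul, (extChartAt 𝓘(ℝ, F) (1 : G)).left_inv h1,
      (extChartAt 𝓘(ℝ, F) (1 : G)).left_inv h2, mul_inv_cancel]
    rfl
  have h2 : mvfderiv 𝓘(ℝ, E) (fun z => chartMul F G (extChartAt 𝓘(ℝ, F) (1 : G) (u z),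
      extChartAt 𝓘(ℝ, F) (1 : G) (u z)⁻¹)) y v = 0 :=
    (mvfderiv_congr ev v).trans
      (congrArg (fun L => L v) (mvfderiv_const (I := 𝓘(ℝ, E)) (x := y) (chartOne F G)))
  rw [h2, mvfderiv_prodMk d1 d2] at h1
  have e : ∀ a b : F, fderiv ℝ (chartMul F G) (chartOne F G, chartOne F G) (a, b) = a + b := by
    intro a b
    have l := congrArg (fun L : F →L[ℝ] F => L a)
      (fderiv_partial_left_self (contDiffAt_chartMul (F := F) (G := G)) chartMul_chartOne_right)
    have r := congrArg (fun L : F →L[ℝ] F => L b)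
      (fderiv_partial_right_self (contDiffAt_chartMul (F := F) (G := G)) chartMul_chartOne_left)
    have s : ((a, b) : F × F) = (a, 0) + (0, b) := by simp
    rw [s, map_add]
    exact congrArg₂ (· + ·) l r
  rw [e] at h1
  exact (neg_eq_of_add_eq_zero_right h1.symm).symm

variable [IsManifold 𝓘(ℝ, E) ∞ X]

/-- The right logarithmic derivative of g⁻¹ at y is the velocity of g(z)⁻¹g(y), the inverse of
g(y)⁻¹g(z). The latter is g(z)g(y)⁻¹ conjugated by g(y)⁻¹, and g(z)g(y)⁻¹ has velocity ξ⁽¹⁾. -/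
theorem rightLogDeriv_inv {g : X → G} {y : X} (hg : ContMDiffAt 𝓘(ℝ, E) 𝓘(ℝ, F) ∞ g y)
    (v : TangentSpace 𝓘(ℝ, E) y) :
    (rightLogDeriv (F := F) (fun z => (g z)⁻¹) y v : F) =
      -modelAd F (g y)⁻¹ (rightLogDeriv (F := F) g y v) := by
  have hu : ContMDiffAt 𝓘(ℝ, E) 𝓘(ℝ, F) ∞ (fun z => (g y)⁻¹ * g z) y :=
    contMDiffAt_const.mul hg
  have h1 := mvfderiv_chart_inv (u := fun z => (g y)⁻¹ * g z) (by simp) hu v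
  have h2 := adjointRep_mvfderiv_chart (u := fun z => g z * (g y)⁻¹) (by simp)
    ((hg.mul contMDiffAt_const).mdifferentiableAt (by simp)) (g y)⁻¹ v
  rw [rightLogDeriv_eq hg.inv]
  simp only [mul_inv_rev, inv_inv, mul_assoc, inv_mul_cancel, mul_one] at h1 h2 ⊢
  rw [h1, ← h2, ← rightLogDeriv_eq hg]
  rfl

/-- Freeze the point y: Ad_{g(z)⁻¹} = Ad_{g(y)⁻¹} ∘ Ad_{h(z)⁻¹} with h(z) = g(z)g(y)⁻¹. The first
factor is constant, and h passes through the unit at y, where the derivative of Ad is known. -/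
theorem mvfderiv_modelAd_inv {g : X → G} {y : X} (hg : ContMDiffAt 𝓘(ℝ, E) 𝓘(ℝ, F) ∞ g y)
    {η : X → F} (hη : MDifferentiableAt 𝓘(ℝ, E) 𝓘(ℝ, F) η y) :
    MDifferentiableAt 𝓘(ℝ, E) 𝓘(ℝ, F) (fun z => modelAd F (g z)⁻¹ (η z)) y ∧
      ∀ v, mvfderiv 𝓘(ℝ, E) (fun z => modelAd F (g z)⁻¹ (η z)) y v =
        modelAd F (g y)⁻¹ (mvfderiv 𝓘(ℝ, E) η y v -
          modelBracket F G (rightLogDeriv (F := F) g y v) (η y)) := by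
  have hu : ContMDiffAt 𝓘(ℝ, E) 𝓘(ℝ, F) ∞ (fun z => g z * (g y)⁻¹) y :=
    hg.mul contMDiffAt_const
  have d1 := mdifferentiableAt_chart_one (u := fun z => (g z * (g y)⁻¹)⁻¹) (by simp) hu.inv
  have h1 := fun v => mvfderiv_chart_inv (u := fun z => g z * (g y)⁻¹) (by simp) hu v
  have d := d1.prodMk_space hη
  have e0 : extChartAt 𝓘(ℝ, F) (1 : G) (g y * (g y)⁻¹)⁻¹ = chartOne F G := by
    simp only [mul_inv_cancel, inv_one]; rfl
  obtain ⟨Φ', hΦ, hΦ'⟩ : ∃ Φ' : F × F →L[ℝ] F, HasFDerivAt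
      (fun q : F × F => modelAd F (g y)⁻¹ (chartAdjoint F G q.1 q.2)) Φ'
      (extChartAt 𝓘(ℝ, F) (1 : G) (g y * (g y)⁻¹)⁻¹, η y) ∧ ∀ a b, Φ' (a, b) =
        modelAd F (g y)⁻¹ (chartAdjoint F G (chartOne F G) b + modelBracket F G a (η y)) := by
    rw [e0]
    exact ⟨_, (modelAd F (g y)⁻¹).hasFDerivAt.comp (chartOne F G, η y)
      ((HasFDerivAt.comp (f := Prod.fst) (chartOne F G, η y)
        (hasFDerivAt_chartAdjoint (F := F) (G := G)).1.hasFDerivAt hasFDerivAt_fst).clm_apply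
        hasFDerivAt_snd), fun _ _ => rfl⟩
  have hc := mvfderiv_comp_hasFDerivAt
    (f := fun z => (extChartAt 𝓘(ℝ, F) (1 : G) (g z * (g y)⁻¹)⁻¹, η z)) hΦ d
  have hs : ∀ᶠ z in 𝓝 y, (g z * (g y)⁻¹)⁻¹ ∈ (extChartAt 𝓘(ℝ, F) (1 : G)).source :=
    hu.inv.continuousAt.eventually_mem (by
      simpa using extChartAt_source_mem_nhds (I := 𝓘(ℝ, F)) (1 : G))
  have ht : Tendsto (fun z => extChartAt 𝓘(ℝ, F) (1 : G) (g z * (g y)⁻¹)⁻¹) (𝓝 y)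
      (𝓝 (chartOne F G)) := e0 ▸ d1.continuousAt
  have ev : (fun z => modelAd F (g z)⁻¹ (η z)) =ᶠ[𝓝 y] fun z => modelAd F (g y)⁻¹
      (chartAdjoint F G (extChartAt 𝓘(ℝ, F) (1 : G) (g z * (g y)⁻¹)⁻¹) (η z)) := by
    filter_upwards [hs, ht.eventually chartAdjoint_eq] with z h2 h3
    have h4 := h3 (η z)
    rw [(extChartAt 𝓘(ℝ, F) (1 : G)).left_inv h2] at h4
    refine Eq.trans ?_ (congrArg (modelAd F (g y)⁻¹) h4)
    refine Eq.trans ?_ (adjointRep_mul _ _ _)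
    simp only [mul_inv_rev, inv_inv, inv_mul_cancel_left]
    rfl
  refine ⟨hc.1.congr_of_eventuallyEq ev, fun v => ?_⟩
  refine (mvfderiv_congr ev v).trans ((hc.2 v).trans ?_)
  -- The argument of `chartAdjoint` has velocity −ξ⁽¹⁾(v), which produces the minus sign in front of
  -- the bracket; at the unit `chartAdjoint` is the identity.
  rw [mvfderiv_prodMk d1 hη, h1, ← rightLogDeriv_eq hg]
  rw [hΦ', chartAdjoint, fderiv_partial_right_self contDiffAt_chartConj chartConj_chartOne_left]
  have e : ∀ a b : F, modelAd F (g y)⁻¹ (ContinuousLinearMap.id ℝ F b +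
      modelBracket F G (-a) (η y)) = modelAd F (g y)⁻¹ (b - modelBracket F G a (η y)) := by
    intro a b
    simp [sub_eq_add_neg]
  exact e _ _

end AdjointDerivative

/-! ### Iterated brackets as continuous multilinear maps, and their Leibniz rule. -/

section IteratedBracket
variable {F : Type*} [NormedAddCommGroup F] [NormedSpace ℝ F]
  {G : Type*} [TopologicalSpace G] [ChartedSpace F G] [Group G]

variable (F G) in
/-- The iterated bracket `(X₀, …, X_l) ↦ ad(X₀) ⋯ ad(X_{l-1})(X_l)`, as a continuous multilinear
map on the model space of the Lie algebra. -/
noncomputable def iteratedBracket : ∀ l : ℕ, ContinuousMultilinearMap ℝ (fun _ : Fin (l + 1) => F) F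
  | 0 =>
    haveI : Subsingleton (Fin (0 + 1)) := inferInstanceAs (Subsingleton (Fin 1))
    ContinuousMultilinearMap.ofSubsingleton ℝ F F 0 (ContinuousLinearMap.id ℝ F)
  | l + 1 => ContinuousLinearMap.uncurryLeft (Ei := fun _ : Fin (l + 2) => F)
      (((ContinuousLinearMap.compContinuousMultilinearMapL ℝ (fun _ : Fin (l + 1) => F) F F).flip
        (iteratedBracket l)).comp (modelBracket F G))

theorem iteratedBracket_eq_adList [LieGroup 𝓘(ℝ, F) ∞ G] :
    ∀ (l : ℕ) (v : Fin (l + 1) → GroupLieAlgebra 𝓘(ℝ, F) G),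
      iteratedBracket F G l v = adList (List.ofFn v)
  | 0, v => by simp only [List.ofFn_succ, List.ofFn_zero, adList]; rfl
  | l + 1, v => by
    have h := iteratedBracket_eq_adList l (Fin.tail v)
    have e : adList (List.ofFn v) = ⁅v 0, adList (List.ofFn (Fin.tail v))⁆ := by
      rw [List.ofFn_succ, List.ofFn_succ, adList]
      simp only [Fin.tail, List.ofFn_succ]
    rw [e, ← h]
    exact modelBracket_eq (v 0) _

variable (F G) in
/-- `ad(X₁) ⋯ ad(X_{l-1})(X_l)` for elements `X₁, …, X_l` of the model space of the Lie algebra. -/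
noncomputable def bracketWord : ∀ {l : ℕ}, (Fin l → F) → F
  | 0, _ => 0
  | l + 1, v => iteratedBracket F G l v

theorem bracketWord_eq_adList [LieGroup 𝓘(ℝ, F) ∞ G] :
    ∀ {l : ℕ} (v : Fin l → GroupLieAlgebra 𝓘(ℝ, F) G),
      bracketWord F G v = adList (List.ofFn v)
  | 0, _ => by simp only [List.ofFn_zero, adList]; rfl
  | l + 1, v => iteratedBracket_eq_adList l v

/-- Positivity of `l` is essential: a word with a single letter `a` equals `a`, and not the bracket
of `a` with the empty word `0`. -/
theorem bracketWord_cons {l : ℕ} (hl : 0 < l) (a : F) (v : Fin l → F) :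
    bracketWord F G (Fin.cons a v : Fin (l + 1) → F) =
      modelBracket F G a (bracketWord F G v) := by
  obtain ⟨l, rfl⟩ := Nat.exists_eq_succ_of_ne_zero hl.ne'
  rfl

theorem bracketWord_update_add {l : ℕ} (v : Fin l → F) (i : Fin l) (a b : F) :
    bracketWord F G (update v i (a + b)) =
      bracketWord F G (update v i a) + bracketWord F G (update v i b) := by
  obtain ⟨l, rfl⟩ := Nat.exists_eq_succ_of_ne_zero i.pos.ne'
  exact (iteratedBracket F G l).map_update_add v i a b

theorem bracketWord_update_sum {l : ℕ} (v : Fin l → F) (i : Fin l) {ι : Type*} (s : Finset ι)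
    (a : ι → F) : bracketWord F G (update v i (∑ r ∈ s, a r)) =
      ∑ r ∈ s, bracketWord F G (update v i (a r)) := by
  obtain ⟨l, rfl⟩ := Nat.exists_eq_succ_of_ne_zero i.pos.ne'
  exact (iteratedBracket F G l).toMultilinearMap.map_update_sum s i a v

variable {E : Type*} [NormedAddCommGroup E] [NormedSpace ℝ E]
  {X : Type*} [TopologicalSpace X] [ChartedSpace E X]

/-- The Leibniz rule, from the derivative of a continuous multilinear map. -/
theorem mvfderiv_bracketWord {l : ℕ} {f : Fin l → X → F} {y : X}
    (hf : ∀ i, MDifferentiableAt 𝓘(ℝ, E) 𝓘(ℝ, F) (f i) y) :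
    MDifferentiableAt 𝓘(ℝ, E) 𝓘(ℝ, F) (fun z => bracketWord F G fun i => f i z) y ∧
      ∀ v, mvfderiv 𝓘(ℝ, E) (fun z => bracketWord F G fun i => f i z) y v =
        ∑ i, bracketWord F G (update (fun i => f i y) i (mvfderiv 𝓘(ℝ, E) (f i) y v)) := by
  cases l with
  | zero =>
    refine ⟨mdifferentiableAt_const, fun v => ?_⟩
    simp only [bracketWord, Finset.univ_eq_empty, Finset.sum_empty]
    exact congrArg (fun L => L v) (mvfderiv_const (I := 𝓘(ℝ, E)) (x := y) (0 : F))
  | succ l =>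
    have h := fun v => mvfderiv_pi hf v
    have hd := (h 0).1
    have hc := mvfderiv_comp_hasFDerivAt (f := fun z i => f i z)
      ((iteratedBracket F G l).hasFDerivAt (fun i => f i y)) hd
    refine ⟨hc.1, fun v => (hc.2 v).trans ?_⟩
    rw [(h v).2, ContinuousMultilinearMap.linearDeriv_apply]
    rfl

end IteratedBracket

/-- Removing the smallest element from a partition leaves a partition of the rest, together with the
information whether that element was alone (`extendLeft`) or in which block it lay (`extendMiddle`).
-/
theorem sum_orderedFinpartition_succ {M : Type*} [AddCommMonoid M] {n : ℕ}
    (f : OrderedFinpartition (n + 1) → M) :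
    ∑ c, f c = ∑ c : OrderedFinpartition n, (f c.extendLeft + ∑ m, f (c.extendMiddle m)) := by
  rw [← (OrderedFinpartition.extendEquiv n).sum_comp f, Fintype.sum_sigma]
  refine Finset.sum_congr rfl fun c _ => ?_
  rw [Fintype.sum_option]
  rfl

/-! ### The partition formula satisfies the recursion of the tensor fields of g⁻¹. -/

section InverseTower
variable {E : Type*} [NormedAddCommGroup E] [NormedSpace ℝ E] [FiniteDimensional ℝ E]
  {X : Type*} [TopologicalSpace X] [T2Space X] [ChartedSpace E X] [IsManifold 𝓘(ℝ, E) ∞ X]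
  {F : Type*} [NormedAddCommGroup F] [NormedSpace ℝ F]
  {G : Type*} [TopologicalSpace G] [ChartedSpace F G] [Group G] [LieGroup 𝓘(ℝ, F) ∞ G]

/-- Block sizes of an extended partition are known only up to propositional equality, so the order
of the tensor has to be transported. -/
theorem xiOp_cast (conn : TangentConnection E X) (g : X → G) {n n' : ℕ} (h : n = n')
    {U : Fin n → VecField E X} {U' : Fin n' → VecField E X} (hU : ∀ r, U r = U' (Fin.cast h r)) :
    xiOp (F := F) conn g n U = xiOp conn g n' U' := by
  subst h
  exact congrArg _ (funext hU)

/-- The definition of the induced connection, solved for the derivative. It requires order at least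
one, as ξ⁽¹⁾ is not the covariant derivative of the dummy ξ⁽⁰⁾. -/
theorem derivAlong_xiOp (conn : TangentConnection E X) (g : X → G) {n : ℕ} (hn : 0 < n)
    (A : VecField E X) (U : Fin n → VecField E X) (y : X) :
    derivAlong A (xiOp (F := F) conn g n U) y =
      xiOp conn g (n + 1) (Fin.cons A U : Fin (n + 1) → VecField E X) y +
        ∑ r, xiOp conn g n (update U r (covAlong conn A (U r))) y := by
  obtain ⟨n, rfl⟩ := Nat.exists_eq_succ_of_ne_zero hn.ne'
  simp only [xiOp, covTensor, Fin.tail_cons, Fin.cons_zero, Fin.cons_succ, Pi.sub_apply,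
    Finset.sum_apply, sub_add_cancel]

variable (F) in
/-- The values at `y` of the factors of the term of the partition `c` in the formula for the
inverse. -/
noncomputable def blockValues (conn : TangentConnection E X) (g : X → G) {j : ℕ}
    (c : OrderedFinpartition j) (V : Fin j → VecField E X) (y : X) (m : Fin c.length) : F :=
  xiOp conn g (c.partSize m) (fun r => V (c.emb m r)) y

variable (F) in
/-- The right-hand side of the formula for the inverse, as a tensor field. -/
noncomputable def inverseTower (conn : TangentConnection E X) (g : X → G) (j : ℕ) :
    TensorOp E X F j :=
  fun V y => ∑ c : OrderedFinpartition j,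
    (-1 : ℝ) ^ c.length • modelAd F (g y)⁻¹ (bracketWord F G (blockValues F conn g c V y))

/-- The new block {0} has the smallest maximum, so its factor ξ⁽¹⁾(V₀) is the outermost one. -/
theorem blockValues_extendLeft (conn : TangentConnection E X) (g : X → G) {j : ℕ}
    (c : OrderedFinpartition j) (V : Fin (j + 1) → VecField E X) (y : X) :
    blockValues F conn g c.extendLeft V y =
      (Fin.cons (rightLogDerivAlong (F := F) (V 0) g y) (blockValues F conn g c (Fin.tail V) y) :
        Fin (c.length + 1) → F) := by
  funext m
  induction m using Fin.cases with
  | zero => rfl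
  | succ m => rfl

/-- The order of the blocks is unchanged, and 0 becomes the first position of its block. This agrees
with the convention that the direction of differentiation is the first argument. -/
theorem blockValues_extendMiddle (conn : TangentConnection E X) (g : X → G) {j : ℕ}
    (c : OrderedFinpartition j) (k : Fin c.length) (V : Fin (j + 1) → VecField E X) (y : X) :
    blockValues F conn g (c.extendMiddle k) V y =
      update (blockValues F conn g c (Fin.tail V) y) k
        (xiOp conn g (c.partSize k + 1)
          (Fin.cons (V 0) (fun r => Fin.tail V (c.emb k r)) :
            Fin (c.partSize k + 1) → VecField E X) y) := by
  refine funext fun m : Fin c.length => ?_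
  by_cases hm : m = k
  · subst hm
    rw [update_self]
    have h : (c.extendMiddle m).partSize m = c.partSize m + 1 := by simp
    refine congrFun (xiOp_cast conn g h fun r => ?_) y
    obtain ⟨r, rfl⟩ : ∃ r' : Fin (c.partSize m + 1), r = Fin.cast h.symm r' := ⟨Fin.cast h r, rfl⟩
    induction r using Fin.cases with
    | zero =>
      simp only [OrderedFinpartition.extendMiddle, dite_true]
      rfl
    | succ r =>
      simp only [OrderedFinpartition.extendMiddle, dite_true]
      rfl
  · rw [update_of_ne hm]
    have h : (c.extendMiddle k).partSize m = c.partSize m := by simp [hm]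
    refine congrFun (xiOp_cast conn g h fun r => ?_) y
    simp only [OrderedFinpartition.extendMiddle, hm, dite_false]
    rfl

theorem blockValues_update (conn : TangentConnection E X) (g : X → G) {j : ℕ}
    (c : OrderedFinpartition j) (U : Fin j → VecField E X) (m : Fin c.length)
    (r : Fin (c.partSize m)) (A : VecField E X) (y : X) :
    blockValues F conn g c (update U (c.emb m r) A) y =
      update (blockValues F conn g c U y) m
        (xiOp conn g (c.partSize m) (update (fun r => U (c.emb m r)) r A) y) := by
  funext m'
  by_cases hm : m' = m
  · subst hm
    rw [update_self]
    refine congrFun (congrArg _ (funext fun r' => ?_)) y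
    by_cases hr : r' = r
    · subst hr; simp
    · rw [update_of_ne hr, update_of_ne ((c.emb_strictMono m').injective.ne hr)]
  · rw [update_of_ne hm]
    refine congrFun (congrArg _ (funext fun r' => ?_)) y
    rw [update_of_ne (c.emb_ne_emb_of_ne hm)]

theorem derivAlong_bracketWord_blockValues (conn : TangentConnection E X) {g : X → G} {j : ℕ}
    (c : OrderedFinpartition j) (V : Fin (j + 1) → VecField E X) {y : X}
    (hd : ∀ m, MDifferentiableAt 𝓘(ℝ, E) 𝓘(ℝ, F)
      (fun z => blockValues F conn g c (Fin.tail V) z m) y) :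
    derivAlong (V 0) (fun z => bracketWord F G (blockValues F conn g c (Fin.tail V) z)) y =
      ∑ m, bracketWord F G (blockValues F conn g (c.extendMiddle m) V y) +
        ∑ i, bracketWord F G (blockValues F conn g c
          (update (Fin.tail V) i (covAlong conn (V 0) (V i.succ))) y) := by
  refine ((mvfderiv_bracketWord hd).2 _).trans ?_
  -- A position i is the same as a block m with a place r in it; after this reindexing both sides
  -- are sums over the blocks.
  rw [← c.equivSigma.sum_comp, Fintype.sum_sigma, ← Finset.sum_add_distrib]
  refine Finset.sum_congr rfl fun m _ => ?_
  have e : mvfderiv 𝓘(ℝ, E) (fun z => blockValues F conn g c (Fin.tail V) z m) y (V 0 y) = _ :=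
    derivAlong_xiOp conn g (c.partSize_pos m) (V 0) (fun r => Fin.tail V (c.emb m r)) y
  rw [e]
  refine (bracketWord_update_add _ _ _ _).trans ?_
  rw [blockValues_extendMiddle, bracketWord_update_sum]
  congr 1
  refine Finset.sum_congr rfl fun r _ => congrArg _ ?_
  exact (blockValues_update conn g c (Fin.tail V) m r _ y).symm

/-- The inductive step: the right-hand side of the formula obeys the same recursion as the tensors
ξ⁽ʲ⁾ of a map. With `0 < j` no word is empty, so adding a block amounts to applying ad. -/
theorem derivAlong_inverseTower (conn : TangentConnection E X) {g : X → G} {j : ℕ} (hj : 0 < j)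
    (V : Fin (j + 1) → VecField E X) {y : X} (hg : ContMDiffAt 𝓘(ℝ, E) 𝓘(ℝ, F) ∞ g y)
    (hd : ∀ (c : OrderedFinpartition j) m, MDifferentiableAt 𝓘(ℝ, E) 𝓘(ℝ, F)
      (fun z => blockValues F conn g c (Fin.tail V) z m) y) :
    derivAlong (V 0) (inverseTower F conn g j (Fin.tail V)) y =
      inverseTower F conn g (j + 1) V y + ∑ i, inverseTower F conn g j
        (update (Fin.tail V) i (covAlong conn (V 0) (V i.succ))) y := by
  have h1 := fun c => mvfderiv_modelAd_inv hg (mvfderiv_bracketWord (G := G) (hd c)).1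
  have h2 := fun c : OrderedFinpartition j => mvfderiv_comp_hasFDerivAt
    (((-1 : ℝ) ^ c.length • ContinuousLinearMap.id ℝ F).hasFDerivAt) (h1 c).1
  have h3 := mvfderiv_pi (fun c => (h2 c).1) (V 0 y)
  -- The sum over partitions is differentiated as the composite of the family of its terms with the
  -- linear map summing the coordinates.
  have h4 := (mvfderiv_comp_hasFDerivAt (HasFDerivAt.fun_sum (u := Finset.univ)
    (A := fun (c : OrderedFinpartition j) (u : OrderedFinpartition j → F) => u c)
    fun c _ => (ContinuousLinearMap.proj (R := ℝ) (φ := fun _ => F) c).hasFDerivAt) h3.1).2 (V 0 y)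
  rw [h3.2] at h4
  refine h4.trans ?_
  rw [_root_.sum_apply]
  simp only [inverseTower]
  -- Partitions of j + 1 elements are grouped by the partition `c` they extend, and the connection
  -- terms likewise, so that it suffices to compare the contributions of one `c`.
  rw [sum_orderedFinpartition_succ, Finset.sum_comm, ← Finset.sum_add_distrib]
  refine Finset.sum_congr rfl fun c _ => ?_
  refine ((h2 c).2 (V 0 y)).trans ?_
  rw [(h1 c).2]
  have e := derivAlong_bracketWord_blockValues conn c V (hd c)
  have e' : mvfderiv 𝓘(ℝ, E) (fun z => bracketWord F G fun i =>
    blockValues F conn g c (Fin.tail V) z i) y (V 0 y) = _ := e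
  have el : bracketWord F G (blockValues F conn g c.extendLeft V y) =
      modelBracket F G (rightLogDerivAlong (F := F) (V 0) g y)
        (bracketWord F G (blockValues F conn g c (Fin.tail V) y)) := by
    rw [blockValues_extendLeft]
    exact bracketWord_cons (c.length_pos hj) _ _
  -- Here `d` is the bracket with ξ⁽¹⁾(V₀); its minus sign is absorbed by the additional block. The
  -- vectors `a` and `b` are the enlarged blocks and the connection terms, with the number of blocks
  -- unchanged.
  have alg : ∀ (A : F →L[ℝ] F) (a b d : F), ((-1 : ℝ) ^ c.length • ContinuousLinearMap.id ℝ F)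
      (A (a + b - d)) = (-1 : ℝ) ^ (c.length + 1) • A d + (-1 : ℝ) ^ c.length • A a +
        (-1 : ℝ) ^ c.length • A b := by
    intro A a b d
    simp only [_root_.smul_apply, ContinuousLinearMap.id_apply, map_sub, map_add,
      pow_succ, mul_neg, mul_one, neg_smul]
    abel
  rw [e', el]
  refine (alg _ _ _ _).trans ?_
  simp only [map_sum, Finset.smul_sum]
  rfl

theorem inverseTower_one (conn : TangentConnection E X) (g : X → G) (V : Fin 1 → VecField E X)
    (y : X) : inverseTower F conn g 1 V y =
      -modelAd F (g y)⁻¹ (rightLogDerivAlong (F := F) (V 0) g y) := by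
  rw [inverseTower, Fintype.sum_unique]
  have e : ∀ a : F, (-1 : ℝ) ^ 1 • a = -a := by simp
  exact e _

/-- The identity is proved on a neighbourhood of x and for all vector fields smooth near x, because
the induction differentiates it and replaces arguments by ∇_{V₀}V_i. -/
theorem xiOp_inv_eq_inverseTower (conn : TangentConnection E X)
    [CovariantDerivative.ContMDiffCovariantDerivative conn ∞] {g : X → G} {x : X}
    (hg : SmoothNear (E := E) (F := F) g x) :
    ∀ (j : ℕ) (V : Fin (j + 1) → VecField E X), (∀ i, SmoothFieldNear (V i) x) →
      xiOp (F := F) conn (fun z => (g z)⁻¹) (j + 1) V =ᶠ[𝓝 x] inverseTower F conn g (j + 1) V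
  | 0, V, hV => by
    filter_upwards [hg] with y hy
    rw [inverseTower_one]
    exact rightLogDeriv_inv hy (V 0 y)
  | j + 1, V, hV => by
    have ht : ∀ i, SmoothFieldNear (Fin.tail V i) x := fun i => hV i.succ
    have h1 := derivAlong_congr (V 0) (xiOp_inv_eq_inverseTower conn hg j _ ht)
    have h2 := eventuallyEq_finsetSum Finset.univ fun (i : Fin (j + 1)) _ =>
      xiOp_inv_eq_inverseTower conn hg j _
        (smoothNear_update ht i ((hV 0).covAlong (conn := conn) (hV i.succ)))
    have h3 : ∀ᶠ y in 𝓝 x, ∀ (c : OrderedFinpartition (j + 1)) (m : Fin c.length),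
        MDifferentiableAt 𝓘(ℝ, E) 𝓘(ℝ, F)
          (fun z => blockValues F conn g c (Fin.tail V) z m) y :=
      eventually_all.2 fun c => eventually_all.2 fun m =>
        ((isTensorNear_xiOp conn hg (c.partSize m)).smooth _ fun r => ht (c.emb m r)).mdiff
    filter_upwards [hg, h1, h2, h3] with y k0 k1 k2 k3
    have h4 := derivAlong_inverseTower conn j.succ_pos V k0 k3
    simp only [xiOp, covTensor, Pi.sub_apply]
    -- The terms containing ∇_{V₀}V_i cancel against those subtracted in `covTensor`.
    refine (congrArg₂ (· - ·) (k1.trans h4) k2).trans ?_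
    simp only [Finset.sum_apply, add_sub_cancel_right]

end InverseTower

/-! ### The image of the inverse jet. -/

/-- `OrderedFinpartition j` lists the blocks by increasing maximum, and `c.emb m` enumerates block m
increasingly, so it is a model of 𝒫ᵃ(j). Positions are numbered from 0. -/
theorem mainTheorem3
    {E : Type*} [NormedAddCommGroup E] [NormedSpace ℝ E] [FiniteDimensional ℝ E]
    {X : Type*} [TopologicalSpace X] [T2Space X] [ChartedSpace E X] [IsManifold 𝓘(ℝ, E) ∞ X]
    {F : Type*} [NormedAddCommGroup F] [NormedSpace ℝ F] [FiniteDimensional ℝ F]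
    {G : Type*} [TopologicalSpace G] [ChartedSpace F G] [Group G] [LieGroup 𝓘(ℝ, F) ∞ G]
    (conn : TangentConnection E X) [CovariantDerivative.ContMDiffCovariantDerivative conn ∞]
    (k : ℕ) (x : X) (a : JetFiber E F G k x)
    (g : G) (ξ : (j : Finset.Icc 1 k) → TensorFiber E F G j x)
    (ha : a.triv conn = (g, ξ)) :
    ∃ ζ : (j : Finset.Icc 1 k) → TensorFiber E F G j x,
      a⁻¹.triv conn = (g⁻¹, ζ) ∧
      ∀ (j : Finset.Icc 1 k) (v : Fin j → TangentSpace 𝓘(ℝ, E) x),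
        ζ j v = ∑ c : OrderedFinpartition j, (-1 : ℝ) ^ c.length •
          adjointRep F g⁻¹ (adList (List.ofFn fun m : Fin c.length =>
            ξ ⟨c.partSize m, Finset.mem_Icc.2
              ⟨c.partSize_pos m, (c.partSize_le m).trans (Finset.mem_Icc.1 j.2).2⟩⟩
              fun r => v (c.emb m r))) := by
  obtain ⟨a, rfl⟩ := Quotient.exists_rep a
  obtain ⟨hg, hξ⟩ := Prod.ext_iff.1 ha
  have hinv : SmoothNear (E := E) (F := F) (fun y => (a.toFun y)⁻¹) x := by
    filter_upwards [a.smooth] with y h using h.inv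
  -- The inverse jet is by construction the jet of the pointwise inverse, so its tensor components
  -- hold by `rfl`.
  refine ⟨fun j => LocalMap.xi conn (⟨fun y => (a.toFun y)⁻¹, hinv⟩ : LocalMap E F G x) j,
    Prod.ext (congrArg (·⁻¹) hg) rfl, ?_⟩
  have hg' : a.toFun x = g := hg
  have hξ' : (fun j : Finset.Icc 1 k => a.xi conn j) = ξ := hξ
  subst hg' hξ'
  rintro ⟨j, hj⟩ v
  obtain ⟨n, rfl⟩ := Nat.exists_eq_succ_of_ne_zero
    (Nat.one_le_iff_ne_zero.1 (Finset.mem_Icc.1 hj).1)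
  -- The value of a tensor at x is defined by evaluation on these extensions, so the identity of
  -- tensor fields at x is already the claim about the vectors `v`.
  have h := (xiOp_inv_eq_inverseTower conn a.smooth n (fun i => FiberBundle.extend E (v i))
    fun i => smoothFieldNear_extend (v i)).eq_of_nhds
  refine h.trans (Finset.sum_congr rfl fun c _ => ?_)
  exact congrArg (fun w => (-1 : ℝ) ^ c.length • modelAd F (a.toFun x)⁻¹ w)
    (bracketWord_eq_adList (G := G)
      (blockValues F conn a.toFun c (fun i => FiberBundle.extend E (v i)) x))
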